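/- Let $\Bbbk$ be a field and let $H$ be a Hopf algebra over $\Bbbk$ with bijective antipode. Let $R$ be a Hopf algebra, with bijective antipode, in the braided category ${}^H_H\mathcal{YD}$ of left-left Yetter–Drinfeld modules over $H$, that is, of $H$-modules and $H$-comodules $V$ whose coaction $\rho(v)=v_{(-1)}\otimes v_{(0)}$ satisfies $\rho(h\cdot v)=h_{(1)}v_{(-1)}\mathcal S(h_{(3)})\otimes h_{(2)}\cdot v_{(0)}$, with braiding $c(v\otimes w)=v_{(-1)}\cdot w\otimes v_{(0)}$. Let $R_0$ be the coradical of $R$ (the sum of its simple subcoalgebras) and let $R_{n+1}=\Delta^{-1}(R\otimes R_n+R_0\otimes R)$, $n\ge 0$, be its coradical filtration. If this filtration is finite, that is, if $R_n=R$ for some $n\ge 0$, then $R$ is co-Frobenius: it admits a non-zero left integral and a non-zero right integral. Here a left (respectively right) integral on $R$ is a linear form $\lambda\in R^*$ such that $f\lambda=f(1)\lambda$ (respectively $\lambda f=f(1)\lambda$) for all $f\in R^*$, where $(fg)(x)=f(x^{(1)})g(x^{(2)})$. -/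

import Mathlib

open scoped TensorProduct

noncomputable section

/-! ### Comodules and Yetter-Drinfeld modules -/

/-- A left comodule `V` over a coalgebra `C`: a coassociative and counital coaction
`v ↦ v₍₋₁₎ ⊗ v₍₀₎`. -/
class LeftComodule (k C V : Type*) [Field k] [AddCommGroup C] [Module k C] [Coalgebra k C]
    [AddCommGroup V] [Module k V] where
  coact : V →ₗ[k] C ⊗[k] V
  coassoc : (TensorProduct.assoc k C C V).toLinearMap ∘ₗ
    (Coalgebra.comul (R := k) (A := C)).rTensor V ∘ₗ coact = coact.lTensor C ∘ₗ coact
  counit_coact : (Coalgebra.counit (R := k) (A := C)).rTensor V ∘ₗ coact = TensorProduct.mk k k V 1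

namespace YetterDrinfeld

section Maps

variable (k H V W : Type*) [Field k] [Ring H] [HopfAlgebra k H]
  [AddCommGroup V] [Module k V] [Module H V] [IsScalarTower k H V]
  [AddCommGroup W] [Module k W] [Module H W] [IsScalarTower k H W]

/-- The action of `H` as a linear map `h ↦ (v ↦ h • v)`. -/
def act : H →ₗ[k] V →ₗ[k] V := (Algebra.lsmul k k V).toLinearMap

/-- The map `a ⊗ c ↦ (x ↦ a x S(c))`. -/
def sandwich : H ⊗[k] H →ₗ[k] H →ₗ[k] H :=
  TensorProduct.lift ((LinearMap.mul k (Module.End k H)).compl₁₂ (LinearMap.mul k H)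
    ((LinearMap.mul k H).flip ∘ₗ HopfAlgebra.antipode k))

/-- The map `a ⊗ b ⊗ c ↦ (x ⊗ v ↦ a x S(c) ⊗ b • v)`. -/
def twist : H ⊗[k] (H ⊗[k] H) →ₗ[k] H ⊗[k] V →ₗ[k] H ⊗[k] V :=
  TensorProduct.homTensorHomMap (RingHom.id k) H V H V ∘ₗ
    TensorProduct.map (sandwich k H) (act k H V) ∘ₗ
    (TensorProduct.assoc k H H H).symm.toLinearMap ∘ₗ
    (TensorProduct.comm k H H).toLinearMap.lTensor H

theorem twist_tmul (a b c x : H) (v : V) :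
    twist k H V (a ⊗ₜ (b ⊗ₜ c)) (x ⊗ₜ v) =
      (a * x * HopfAlgebra.antipode k c) ⊗ₜ[k] (b • v) := by
  simp [twist, sandwich, act, mul_assoc]

/-- The map `a ⊗ b ↦ (v ⊗ w ↦ a • v ⊗ b • w)`; composed with the comultiplication of `H` it is
the diagonal action on `V ⊗ W`. -/
def tensorAct : H ⊗[k] H →ₗ[k] V ⊗[k] W →ₗ[k] V ⊗[k] W :=
  TensorProduct.homTensorHomMap (RingHom.id k) V W V W ∘ₗ
    TensorProduct.map (act k H V) (act k H W)

theorem tensorAct_tmul (a b : H) (v : V) (w : W) :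
    tensorAct k H V W (a ⊗ₜ b) (v ⊗ₜ w) = (a • v) ⊗ₜ[k] (b • w) := by
  simp [tensorAct, act]

end Maps

end YetterDrinfeld

/-- A (left-left) Yetter-Drinfeld module over `H`: a module and comodule with
`ρ(h • v) = h₍₁₎ v₍₋₁₎ S(h₍₃₎) ⊗ h₍₂₎ • v₍₀₎`. -/
class YetterDrinfeldModule (k H V : Type*) [Field k] [Ring H] [HopfAlgebra k H]
    [AddCommGroup V] [Module k V] [Module H V] [IsScalarTower k H V]
    extends LeftComodule k H V where
  coact_smul : ∀ (h : H) (v : V), coact (h • v) =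
    YetterDrinfeld.twist k H V
      ((Coalgebra.comul (R := k) (A := H)).lTensor H (Coalgebra.comul (R := k) h)) (coact v)

namespace YetterDrinfeld

section Coact

variable (k H V W : Type*) [Field k] [Ring H] [HopfAlgebra k H]
  [AddCommGroup V] [Module k V] [Module H V] [IsScalarTower k H V] [YetterDrinfeldModule k H V]
  [AddCommGroup W] [Module k W] [Module H W] [IsScalarTower k H W] [YetterDrinfeldModule k H W]

/-- The coaction `v ↦ v₍₋₁₎ ⊗ v₍₀₎` of `H` on a Yetter-Drinfeld module. -/
abbrev coact : V →ₗ[k] H ⊗[k] V := LeftComodule.coact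

/-- The codiagonal coaction `v ⊗ w ↦ v₍₋₁₎ w₍₋₁₎ ⊗ (v₍₀₎ ⊗ w₍₀₎)`. -/
def tensorCoact : V ⊗[k] W →ₗ[k] H ⊗[k] (V ⊗[k] W) :=
  (LinearMap.mul' k H).rTensor (V ⊗[k] W) ∘ₗ
    (TensorProduct.tensorTensorTensorComm k H V H W).toLinearMap ∘ₗ
    TensorProduct.map (coact k H V) (coact k H W)

/-- The braiding `c(v ⊗ w) = v₍₋₁₎ • w ⊗ v₍₀₎`. -/
def braiding : V ⊗[k] W →ₗ[k] W ⊗[k] V :=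
  (TensorProduct.lift (act k H W)).rTensor V ∘ₗ
    (TensorProduct.assoc k H W V).symm.toLinearMap ∘ₗ
    (TensorProduct.comm k V W).toLinearMap.lTensor H ∘ₗ
    (TensorProduct.assoc k H V W).toLinearMap ∘ₗ
    (coact k H V).rTensor W

end Coact

/-- The multiplication `(m ⊗ m)(id ⊗ c ⊗ id)` of the braided tensor product algebra `R ⊗ R`. -/
def braidedMul (k H R : Type*) [Field k] [Ring H] [HopfAlgebra k H] [Ring R] [Algebra k R]
    [Module H R] [IsScalarTower k H R] [YetterDrinfeldModule k H R] :
    (R ⊗[k] R) ⊗[k] (R ⊗[k] R) →ₗ[k] R ⊗[k] R :=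
  TensorProduct.map (LinearMap.mul' k R) (LinearMap.mul' k R) ∘ₗ
    (TensorProduct.assoc k R R (R ⊗[k] R)).symm.toLinearMap ∘ₗ
    ((TensorProduct.assoc k R R R).toLinearMap ∘ₗ (braiding k H R R).rTensor R ∘ₗ
      (TensorProduct.assoc k R R R).symm.toLinearMap).lTensor R ∘ₗ
    (TensorProduct.assoc k R R (R ⊗[k] R)).toLinearMap

end YetterDrinfeld

/-! ### Hopf algebras in the category of Yetter-Drinfeld modules -/

open YetterDrinfeld in
/-- A Hopf algebra `R` in the braided category of Yetter-Drinfeld modules over `H`: an algebra and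
a coalgebra whose structure maps are `H`-linear and `H`-colinear, whose comultiplication and counit
are algebra maps for the braided tensor product algebra `R ⊗ R`, with an antipode. -/
class BraidedHopfAlgebra (k H R : Type*) [Field k] [Ring H] [HopfAlgebra k H]
    [Ring R] [Algebra k R] [Coalgebra k R] [Module H R] [IsScalarTower k H R]
    [YetterDrinfeldModule k H R] where
  /- the unit and the multiplication are `H`-linear -/
  smul_one : ∀ h : H, h • (1 : R) = Coalgebra.counit (R := k) h • (1 : R)
  smul_mul : ∀ (h : H) (x y : R), h • (x * y) =
    LinearMap.mul' k R (tensorAct k H R R (Coalgebra.comul h) (x ⊗ₜ y))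
  /- the unit and the multiplication are `H`-colinear -/
  coact_one : coact k H R 1 = 1 ⊗ₜ 1
  coact_mul : ∀ x y : R, coact k H R (x * y) =
    (LinearMap.mul' k R).lTensor H (tensorCoact k H R R (x ⊗ₜ y))
  /- the counit and the comultiplication are `H`-linear -/
  counit_smul : ∀ (h : H) (x : R), Coalgebra.counit (R := k) (h • x) =
    Coalgebra.counit (R := k) h * Coalgebra.counit (R := k) x
  comul_smul : ∀ (h : H) (x : R), Coalgebra.comul (R := k) (h • x) =
    tensorAct k H R R (Coalgebra.comul h) (Coalgebra.comul x)
  /- the counit and the comultiplication are `H`-colinear -/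
  counit_coact : ∀ x : R, (Coalgebra.counit (R := k) (A := R)).lTensor H (coact k H R x) =
    1 ⊗ₜ Coalgebra.counit (R := k) x
  comul_coact : ∀ x : R, (Coalgebra.comul (R := k) (A := R)).lTensor H (coact k H R x) =
    tensorCoact k H R R (Coalgebra.comul x)
  /- the counit and the comultiplication are algebra maps -/
  counit_one : Coalgebra.counit (R := k) (1 : R) = 1
  counit_mul : ∀ x y : R, Coalgebra.counit (R := k) (x * y) =
    Coalgebra.counit (R := k) x * Coalgebra.counit (R := k) y
  comul_one : Coalgebra.comul (R := k) (1 : R) = 1 ⊗ₜ 1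
  comul_mul : ∀ x y : R, Coalgebra.comul (R := k) (x * y) =
    braidedMul k H R (Coalgebra.comul x ⊗ₜ Coalgebra.comul y)
  /- the antipode: an `H`-linear and `H`-colinear convolution inverse of the identity -/
  antipode (k H) : R →ₗ[k] R
  antipode_smul : ∀ (h : H) (x : R), antipode (h • x) = h • antipode x
  antipode_coact : ∀ x : R, coact k H R (antipode x) = antipode.lTensor H (coact k H R x)
  mul_antipode_rTensor_comul : LinearMap.mul' k R ∘ₗ antipode.rTensor R ∘ₗ Coalgebra.comul =
    Algebra.linearMap k R ∘ₗ Coalgebra.counit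
  mul_antipode_lTensor_comul : LinearMap.mul' k R ∘ₗ antipode.lTensor R ∘ₗ Coalgebra.comul =
    Algebra.linearMap k R ∘ₗ Coalgebra.counit

/-! ### The coradical filtration -/

section Coradical

variable (k : Type*) {C : Type*} [Field k] [AddCommGroup C] [Module k C]

/-- The subspace `U ⊗ W` of `C ⊗ C`. -/
def tensorSubspace (U W : Submodule k C) : Submodule k (C ⊗[k] C) :=
  Submodule.map₂ (TensorProduct.mk k C C) U W

variable [Coalgebra k C]

/-- `D` is a subcoalgebra: `Δ(D) ⊆ D ⊗ D`. -/
def IsSubcoalgebra (D : Submodule k C) : Prop :=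
  D ≤ (tensorSubspace k D D).comap Coalgebra.comul

/-- `D` is a simple subcoalgebra: it is nonzero and has no subcoalgebras but `0` and `D`. -/
def IsSimpleSubcoalgebra (D : Submodule k C) : Prop :=
  IsSubcoalgebra k D ∧ D ≠ ⊥ ∧ ∀ E : Submodule k C, E ≤ D → IsSubcoalgebra k E → E = ⊥ ∨ E = D

variable (C)

/-- The coradical `C₀`: the sum of all simple subcoalgebras. -/
def coradical : Submodule k C := sSup {D | IsSimpleSubcoalgebra k D}

/-- The coradical filtration: `C₀` is the coradical and
`Cₙ₊₁ = Δ⁻¹(C ⊗ Cₙ + C₀ ⊗ C)`. -/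
def coradicalFiltration : ℕ → Submodule k C
  | 0 => coradical k C
  | n + 1 => (tensorSubspace k ⊤ (coradicalFiltration n) ⊔
      tensorSubspace k (coradical k C) ⊤).comap Coalgebra.comul

/-- The coradical filtration is finite: `Cₙ = C` for some `n`. -/
def HasFiniteCoradicalFiltration : Prop := ∃ n, coradicalFiltration k C n = ⊤

end Coradical

/-! ### Integrals -/

section Integrals

variable (k R : Type*) [Field k] [Ring R] [Algebra k R] [Coalgebra k R]

/-- The left integrals: `l ∈ R*` with `f l = f(1) l` for all `f ∈ R*`, where the product of `R*` is
the convolution `(f g)(x) = f(x₍₁₎) g(x₍₂₎)`. -/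
def leftIntegrals : Submodule k (WithConv (R →ₗ[k] k)) where
  carrier := {l | ∀ f : WithConv (R →ₗ[k] k), f * l = f.ofConv 1 • l}
  zero_mem' f := by simp
  add_mem' ha hb f := by rw [mul_add, ha f, hb f, smul_add]
  smul_mem' c a ha f := by rw [mul_smul_comm, ha f, smul_comm]

/-- The right integrals: `l ∈ R*` with `l f = f(1) l` for all `f ∈ R*`. -/
def rightIntegrals : Submodule k (WithConv (R →ₗ[k] k)) where
  carrier := {l | ∀ f : WithConv (R →ₗ[k] k), l * f = f.ofConv 1 • l}
  zero_mem' f := by simp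
  add_mem' ha hb f := by rw [add_mul, ha f, hb f, smul_add]
  smul_mem' c a ha f := by rw [smul_mul_assoc, ha f, smul_comm]

/-- Left co-Frobenius: there is a nonzero left integral. -/
def IsLeftCoFrobenius : Prop := leftIntegrals k R ≠ ⊥

/-- Right co-Frobenius: there is a nonzero right integral. -/
def IsRightCoFrobenius : Prop := rightIntegrals k R ≠ ⊥

/-- Co-Frobenius, on both sides. -/
def IsCoFrobenius : Prop := IsLeftCoFrobenius k R ∧ IsRightCoFrobenius k R

end Integrals

end

/-! Let J be the space of functionals on R that vanish on R₀. The power Jⁿ⁺¹ kills Rₙ, so a finite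
filtration makes J nilpotent. A nonzero g in the last nonzero power satisfies Jg = gJ = 0, which
forces all x₍₁₎ g(x₍₂₎) and g(x₍₁₎) x₍₂₎ into R₀ (`exists_ne_zero_contract_mem_coradical`). Since R₀
is semisimple under the two actions of R*, multiplying g by a suitable functional gives f ≠ 0 whose
contractions lie in a finite-dimensional subcoalgebra. A basis of the latter yields functionals Fⱼ,
not all zero, with x₍₁₎ Fⱼ(x₍₂₎) = ∑ Fᵢ(x) aᵢⱼ, where Δ(aᵢⱼ) = ∑ aᵢₗ ⊗ aₗⱼ and ε(aᵢⱼ) = δᵢⱼ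
(`exists_matrix_contractRight`).

The antipode then trivializes the matrix. For an ordinary Hopf algebra choose pᵢⱼ with S²(pᵢⱼ) = aᵢⱼ
and put lⱼ(x) = ∑ Fᵢ(pᵢⱼ x). From x₍₁₎ ⊗ p x₍₂₎ = S(p₍₁₎) p₍₂₎ x₍₁₎ ⊗ p₍₃₎ x₍₂₎ one gets x₍₁₎
lⱼ(x₍₂₎) = ∑ Fₘ(pₗⱼ x) S(S(pₘᵢ) pᵢₗ) = lⱼ(x) 1. The Fₗ are recovered from the lⱼ, so some lⱼ is
nonzero.

In the braided case S is replaced by the antipode of the bosonization R#H, which acts on R: left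
multiplication by S(r) becomes κ(r) : x ↦ S(r₍₋₁₎) • (S(r₍₀₎) x), and S² becomes `bosonSquare`, a
bijective coalgebra map of R. All identities are stated for operators on R and R ⊗ R, so R#H itself
is not constructed. The main ones are `legTwo_lm_eq_sum`, `legOne_bosonAntipode_antipode_eq_sum` and
`sum_bosonAntipode_mul_bosonAntipode`; they feed `contractRight_sum_eq` and `contractLeft_sum_eq`.
-/

noncomputable section

/-! ### Convolution of linear maps into an algebra -/

section Convolution

variable {k C A : Type*} [Field k] [AddCommGroup C] [Module k C] [Coalgebra k C]
  [Ring A] [Algebra k A]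

/-- The convolution product `(F ⋆ G)(x) = F(x₍₁₎) G(x₍₂₎)`. -/
def conv (F G : C →ₗ[k] A) : C →ₗ[k] A :=
  LinearMap.mul' k A ∘ₗ TensorProduct.map F G ∘ₗ Coalgebra.comul

variable (k C A) in
/-- The unit `x ↦ ε(x) 1` of the convolution product. -/
def convUnit : C →ₗ[k] A := Algebra.linearMap k A ∘ₗ Coalgebra.counit

theorem convUnit_apply (x : C) : convUnit k C A x = Coalgebra.counit (R := k) x • (1 : A) :=
  Algebra.algebraMap_eq_smul_one _

theorem conv_assoc (F G K : C →ₗ[k] A) : conv (conv F G) K = conv F (conv G K) :=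
  congrArg WithConv.ofConv
    (mul_assoc (WithConv.toConv F) (WithConv.toConv G) (WithConv.toConv K))

theorem convUnit_conv (F : C →ₗ[k] A) : conv (convUnit k C A) F = F :=
  congrArg WithConv.ofConv (one_mul (WithConv.toConv F))

theorem conv_convUnit (F : C →ₗ[k] A) : conv F (convUnit k C A) = F :=
  congrArg WithConv.ofConv (mul_one (WithConv.toConv F))

theorem conv_apply_of_comul_eq {ι : Type*} {s : Finset ι} {x : C} {a b : ι → C}
    (h : Coalgebra.comul (R := k) x = ∑ i ∈ s, a i ⊗ₜ[k] b i) (F G : C →ₗ[k] A) :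
    conv F G x = ∑ i ∈ s, F (a i) * G (b i) := by
  simp [conv, h]

theorem algHom_comp_conv {B : Type*} [Ring B] [Algebra k B] (j : A →ₐ[k] B) (F G : C →ₗ[k] A) :
    j.toLinearMap ∘ₗ conv F G = conv (j.toLinearMap ∘ₗ F) (j.toLinearMap ∘ₗ G) :=
  LinearMap.algHom_comp_convMul_distrib j (WithConv.toConv F) (WithConv.toConv G)

theorem algHom_comp_convUnit {B : Type*} [Ring B] [Algebra k B] (j : A →ₐ[k] B) :
    j.toLinearMap ∘ₗ convUnit k C A = convUnit k C B := by
  ext x; simp [convUnit_apply]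

theorem exists_comul_eq (x : C) : ∃ (s : Finset (C × C)),
    Coalgebra.comul (R := k) x = ∑ i ∈ s, i.1 ⊗ₜ[k] i.2 :=
  TensorProduct.exists_finset _

/-- If `D` intertwines `P` with `Y`, it intertwines the convolution inverses of `P` and `Y`. -/
theorem intertwine_convInverse {M N : Type*} [AddCommGroup M] [Module k M] [AddCommGroup N]
    [Module k N] (D : M →ₗ[k] N) {P P' : C →ₗ[k] Module.End k M} {Y Y' : C →ₗ[k] Module.End k N}
    (hP : conv P P' = convUnit k C _) (hY : conv Y' Y = convUnit k C _)
    (hD : ∀ x m, D (P x m) = Y x (D m)) (x : C) (m : M) : D (P' x m) = Y' x (D m) := by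
  -- The map is evaluated on x₍₁₎ ⊗ x₍₂₎ ⊗ x₍₃₎ in both bracketings: Y' ⋆ Y collapses the left pair;
  -- on the right, D turns Y into P and P ⋆ P' collapses.
  let T : C ⊗[k] (C ⊗[k] C) →ₗ[k] N :=
    TensorProduct.lift ((LinearMap.lcomp k N (TensorProduct.lift
      ((LinearMap.llcomp k C N N).flip (D ∘ₗ P'.flip m) ∘ₗ Y))) ∘ₗ Y')
  have hT : ∀ a b c, T (a ⊗ₜ (b ⊗ₜ c)) = Y' a (Y b (D (P' c m))) := fun a b c => rfl
  have h1 : ∀ t : C ⊗[k] C, T (TensorProduct.assoc k C C C (Coalgebra.comul.rTensor C t)) =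
      TensorProduct.lift ((LinearMap.llcomp k C N N).flip (D ∘ₗ P'.flip m) ∘ₗ conv Y' Y) t := by
    intro t
    induction t with
    | zero => simp
    | add a b ha hb => simp only [map_add, ha, hb]
    | tmul a c =>
      obtain ⟨s, hs⟩ := exists_comul_eq (k := k) a
      simp [hs, conv_apply_of_comul_eq hs, TensorProduct.sum_tmul, hT]
  have h2 : ∀ t : C ⊗[k] C, T (Coalgebra.comul.lTensor C t) =
      TensorProduct.lift ((LinearMap.lcomp k N (D ∘ₗ (conv P P').flip m)) ∘ₗ Y') t := by
    intro t
    induction t with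
    | zero => simp
    | add a b ha hb => simp only [map_add, ha, hb]
    | tmul a c =>
      obtain ⟨s, hs⟩ := exists_comul_eq (k := k) c
      simp [hs, conv_apply_of_comul_eq hs, TensorProduct.tmul_sum, hT, hD]
  have h3 := h1 (Coalgebra.comul x)
  rw [Coalgebra.coassoc_apply, h2, hY, hP] at h3
  obtain ⟨s, hs⟩ := exists_comul_eq (k := k) x
  have h4 := congrArg (TensorProduct.lid k C) (Coalgebra.rTensor_counit_comul (R := k) x)
  have h5 := congrArg (TensorProduct.rid k C) (Coalgebra.lTensor_counit_comul (R := k) x)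
  simp only [hs, map_sum, LinearMap.rTensor_tmul, LinearMap.lTensor_tmul, TensorProduct.lid_tmul,
    TensorProduct.rid_tmul, one_smul] at h4 h5
  have h6 := congrArg (fun z => D (P' z m)) h4
  have h7 := congrArg (fun z => Y' z (D m)) h5
  simp only [map_sum, map_smul, LinearMap.sum_apply, LinearMap.smul_apply] at h6 h7
  rw [← h6, ← h7]
  simpa [hs, convUnit_apply] using h3.symm

end Convolution

/-! ### The action of linear maps on a comodule -/

section Coaction

variable {k H V A : Type*} [Field k] [Ring H] [HopfAlgebra k H] [AddCommGroup V] [Module k V]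
  [LeftComodule k H V] [Ring A] [Algebra k A]

/-- The map `v ↦ φ(v₍₋₁₎) G(v₍₀₎)`. -/
def coactConv (φ : H →ₗ[k] A) (G : V →ₗ[k] A) : V →ₗ[k] A :=
  LinearMap.mul' k A ∘ₗ TensorProduct.map φ G ∘ₗ LeftComodule.coact

theorem coactConv_apply (φ : H →ₗ[k] A) (G : V →ₗ[k] A) (v : V) :
    coactConv φ G v = LinearMap.mul' k A (TensorProduct.map φ G (LeftComodule.coact v)) := rfl

theorem exists_coact_eq (v : V) : ∃ (s : Finset (H × V)),
    LeftComodule.coact v = ∑ i ∈ s, i.1 ⊗ₜ[k] i.2 :=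
  TensorProduct.exists_finset _

theorem coactConv_apply_of_coact_eq {ι : Type*} {s : Finset ι} {v : V} {a : ι → H} {b : ι → V}
    (h : LeftComodule.coact v = ∑ i ∈ s, a i ⊗ₜ[k] b i) (φ : H →ₗ[k] A) (G : V →ₗ[k] A) :
    coactConv φ G v = ∑ i ∈ s, φ (a i) * G (b i) := by
  simp [coactConv, h]

/-- Coassociativity of the coaction makes Hom(V, A) a module over the convolution algebra Hom(H, A).
This is what later cancels the action of `H` against that of its antipode. -/
theorem coactConv_conv (φ φ' : H →ₗ[k] A) (G : V →ₗ[k] A) :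
    coactConv (conv φ φ') G = coactConv φ (coactConv φ' G) := by
  let T : H ⊗[k] (H ⊗[k] V) →ₗ[k] A :=
    LinearMap.mul' k A ∘ₗ TensorProduct.map φ (LinearMap.mul' k A ∘ₗ TensorProduct.map φ' G)
  have h1 : ∀ t : H ⊗[k] V, T (TensorProduct.assoc k H H V (Coalgebra.comul.rTensor V t)) =
      LinearMap.mul' k A (TensorProduct.map (conv φ φ') G t) := by
    intro t
    induction t with
    | zero => simp
    | add a b ha hb => simp only [map_add, ha, hb]
    | tmul a c =>
      obtain ⟨s, hs⟩ := exists_comul_eq (k := k) a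
      simp [hs, conv_apply_of_comul_eq hs, TensorProduct.sum_tmul, T, mul_assoc]
  have h2 : ∀ t : H ⊗[k] V, T (LeftComodule.coact.lTensor H t) =
      LinearMap.mul' k A (TensorProduct.map φ (coactConv φ' G) t) := by
    intro t
    induction t with
    | zero => simp
    | add a b ha hb => simp only [map_add, ha, hb]
    | tmul a c => simp [T, coactConv]
  ext v
  rw [coactConv_apply, ← h1]
  exact (congrArg T (LinearMap.congr_fun LeftComodule.coassoc v)).trans (h2 _)

theorem coactConv_convUnit (G : V →ₗ[k] A) : coactConv (convUnit k H A) G = G := by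
  ext v
  obtain ⟨s, hs⟩ := exists_coact_eq (k := k) (H := H) v
  have h := LinearMap.congr_fun (LeftComodule.counit_coact (k := k) (C := H) (V := V)) v
  have h' := congrArg (fun z => G (TensorProduct.lid k V z)) h
  simpa [hs, coactConv_apply_of_coact_eq hs, convUnit_apply] using h'

theorem algHom_comp_coactConv {B : Type*} [Ring B] [Algebra k B] (j : A →ₐ[k] B)
    (φ : H →ₗ[k] A) (G : V →ₗ[k] A) :
    j.toLinearMap ∘ₗ coactConv φ G = coactConv (j.toLinearMap ∘ₗ φ) (j.toLinearMap ∘ₗ G) := by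
  ext v
  obtain ⟨s, hs⟩ := exists_coact_eq (k := k) (H := H) v
  simp [coactConv_apply_of_coact_eq hs]

end Coaction
end

/-! ### Convolution along the coaction of a braided Hopf algebra -/

noncomputable section

namespace BraidedHopf

open YetterDrinfeld

variable {k H R : Type*} [Field k] [Ring H] [HopfAlgebra k H]
    [Ring R] [Algebra k R] [Coalgebra k R] [Module H R] [IsScalarTower k H R]
    [YetterDrinfeldModule k H R] [BraidedHopfAlgebra k H R]

section Colinear

variable {A : Type*} [Ring A] [Algebra k A]

omit [Coalgebra k R] [BraidedHopfAlgebra k H R] in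
theorem tensorCoact_tmul_eq_sum {ι κ : Type*} {s : Finset ι} {u : Finset κ} {x y : R}
    {a : ι → H} {b : ι → R} {c : κ → H} {d : κ → R}
    (hx : coact k H R x = ∑ i ∈ s, a i ⊗ₜ[k] b i) (hy : coact k H R y = ∑ j ∈ u, c j ⊗ₜ[k] d j) :
    tensorCoact k H R R (x ⊗ₜ y) = ∑ i ∈ s, ∑ j ∈ u, (a i * c j) ⊗ₜ[k] (b i ⊗ₜ[k] d j) := by
  simp [tensorCoact, hx, hy, TensorProduct.sum_tmul, TensorProduct.tmul_sum]
  exact Finset.sum_comm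

/-- Colinearity of Δ splits r₍₋₁₎ into a product over the two factors; an antimultiplicative φ
reverses it, so the φ of the second factor ends up to the left of the whole first block. -/
theorem coactConv_conv_eq_sum_of_antihom {φ : H →ₗ[k] A} (hφ : ∀ a b, φ (a * b) = φ b * φ a)
    (G W : R →ₗ[k] A) {ι : Type*} {s : Finset ι} {r : R} {a b : ι → R}
    (h : Coalgebra.comul (R := k) r = ∑ i ∈ s, a i ⊗ₜ[k] b i) :
    coactConv φ (conv G W) r =
      ∑ i ∈ s, coactConv (LinearMap.mulRight k (coactConv φ G (a i)) ∘ₗ φ) W (b i) := by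
  let T : H ⊗[k] (R ⊗[k] R) →ₗ[k] A :=
    LinearMap.mul' k A ∘ₗ TensorProduct.map φ (LinearMap.mul' k A ∘ₗ TensorProduct.map G W)
  have h1 : ∀ t : H ⊗[k] R, LinearMap.mul' k A (TensorProduct.map φ (conv G W) t) =
      T (Coalgebra.comul.lTensor H t) := by
    intro t
    induction t with
    | zero => simp
    | add a b ha hb => simp only [map_add, ha, hb]
    | tmul a c => simp [T, conv]
  rw [coactConv_apply, h1, BraidedHopfAlgebra.comul_coact, h, map_sum, map_sum]
  refine Finset.sum_congr rfl fun i _ => ?_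
  obtain ⟨s', hs'⟩ := exists_coact_eq (k := k) (H := H) (a i)
  obtain ⟨u, hu⟩ := exists_coact_eq (k := k) (H := H) (b i)
  rw [tensorCoact_tmul_eq_sum hs' hu, coactConv_apply_of_coact_eq hu,
    coactConv_apply_of_coact_eq hs', Finset.sum_comm]
  simp [T, hφ, Finset.sum_mul, Finset.mul_sum, mul_assoc]

theorem coactConv_conv_of_antihom {φ : H →ₗ[k] A} (hφ : ∀ a b, φ (a * b) = φ b * φ a)
    (G W : R →ₗ[k] A) (hc : ∀ h x, Commute (φ h) (coactConv φ G x)) :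
    coactConv φ (conv G W) = conv (coactConv φ G) (coactConv φ W) := by
  ext r
  obtain ⟨s, hs⟩ := exists_comul_eq (k := k) r
  rw [coactConv_conv_eq_sum_of_antihom hφ G W hs, conv_apply_of_comul_eq hs]
  refine Finset.sum_congr rfl fun i _ => ?_
  obtain ⟨u, hu⟩ := exists_coact_eq (k := k) (H := H) i.2
  simp [coactConv_apply_of_coact_eq hu, Finset.mul_sum, (hc _ _).eq, mul_assoc]

theorem coactConv_conv_of_hom {φ : H →ₗ[k] A} (hφ : ∀ a b, φ (a * b) = φ a * φ b)
    (G W : R →ₗ[k] A) (hc : ∀ h x, Commute (φ h) (G x)) :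
    coactConv φ (conv G W) = conv (coactConv φ G) (coactConv φ W) := by
  let T : H ⊗[k] (R ⊗[k] R) →ₗ[k] A :=
    LinearMap.mul' k A ∘ₗ TensorProduct.map φ (LinearMap.mul' k A ∘ₗ TensorProduct.map G W)
  have h1 : ∀ t : H ⊗[k] R, LinearMap.mul' k A (TensorProduct.map φ (conv G W) t) =
      T (Coalgebra.comul.lTensor H t) := by
    intro t
    induction t with
    | zero => simp
    | add a b ha hb => simp only [map_add, ha, hb]
    | tmul a c => simp [T, conv]
  ext r
  obtain ⟨s, hs⟩ := exists_comul_eq (k := k) r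
  rw [coactConv_apply, h1, BraidedHopfAlgebra.comul_coact, hs, conv_apply_of_comul_eq hs,
    map_sum, map_sum]
  refine Finset.sum_congr rfl fun i _ => ?_
  obtain ⟨s', hs'⟩ := exists_coact_eq (k := k) (H := H) i.1
  obtain ⟨u, hu⟩ := exists_coact_eq (k := k) (H := H) i.2
  rw [tensorCoact_tmul_eq_sum hs' hu, coactConv_apply_of_coact_eq hu,
    coactConv_apply_of_coact_eq hs']
  simp only [map_sum, Finset.sum_mul_sum]
  refine Finset.sum_congr rfl fun p _ => Finset.sum_congr rfl fun q _ => ?_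
  simp [T, hφ, mul_assoc]
  rw [← mul_assoc (φ _) (G _), (hc _ _).eq, mul_assoc]

theorem coactConv_unit {φ : H →ₗ[k] A} (hφ : φ 1 = 1) :
    coactConv φ (convUnit k R A) = convUnit k R A := by
  ext r
  have h := congrArg (fun z => LinearMap.mul' k A (TensorProduct.map φ (Algebra.linearMap k A) z))
    (BraidedHopfAlgebra.counit_coact (k := k) (H := H) r)
  simp only [← LinearMap.comp_apply] at h
  obtain ⟨s, hs⟩ := exists_coact_eq (k := k) (H := H) r
  simpa [hs, coactConv_apply_of_coact_eq hs, convUnit, hφ] using h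

end Colinear

section Operators

variable (k H R)

/-- The antipode of `R`. -/
abbrev S : R →ₗ[k] R := BraidedHopfAlgebra.antipode k H

/-- Left multiplication. -/
abbrev lm : R →ₗ[k] Module.End k R := LinearMap.mul k R

/-- Left multiplication by the antipode. -/
abbrev lmS : R →ₗ[k] Module.End k R := lm k R ∘ₗ S k H R

omit [Coalgebra k R] [YetterDrinfeldModule k H R] [BraidedHopfAlgebra k H R] in
theorem act_apply (h : H) (x : R) : act k H R h x = h • x := rfl

/-- The action of the antipode of `H`. -/
abbrev actS : H →ₗ[k] Module.End k R := act k H R ∘ₗ HopfAlgebra.antipode k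

/-- The operators `x ↦ S(r₍₋₁₎) • (S(r₍₀₎) x)`; this is the action on `R` of the antipode of `r` in
the bosonization of `R`. -/
def bosonAntipode : R →ₗ[k] Module.End k R := coactConv (actS k H R) (lmS k H R)

theorem conv_lm_lmS : conv (lm k R) (lmS k H R) = convUnit k R _ := by
  ext r x
  have h := LinearMap.congr_fun
    (BraidedHopfAlgebra.mul_antipode_lTensor_comul (k := k) (H := H) (R := R)) r
  obtain ⟨s, hs⟩ := exists_comul_eq (k := k) r
  have h' := congrArg (· * x) h
  simpa [hs, conv_apply_of_comul_eq hs, convUnit_apply, Finset.sum_mul, mul_assoc,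
    Algebra.algebraMap_eq_smul_one] using h'

theorem conv_lmS_lm : conv (lmS k H R) (lm k R) = convUnit k R _ := by
  ext r x
  have h := LinearMap.congr_fun
    (BraidedHopfAlgebra.mul_antipode_rTensor_comul (k := k) (H := H) (R := R)) r
  obtain ⟨s, hs⟩ := exists_comul_eq (k := k) r
  have h' := congrArg (· * x) h
  simpa [hs, conv_apply_of_comul_eq hs, convUnit_apply, Finset.sum_mul, mul_assoc,
    Algebra.algebraMap_eq_smul_one] using h'

omit [Coalgebra k R] [YetterDrinfeldModule k H R] [BraidedHopfAlgebra k H R] in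
theorem conv_act_actS : conv (act k H R) (actS k H R) = convUnit k H _ := by
  ext h x
  have h' := congrArg (· • x) (HopfAlgebra.mul_antipode_lTensor_comul_apply (R := k) h)
  obtain ⟨s, hs⟩ := exists_comul_eq (k := k) h
  simpa [hs, conv_apply_of_comul_eq hs, convUnit_apply, Finset.sum_smul, mul_smul, act_apply]
    using h'

omit [Coalgebra k R] [YetterDrinfeldModule k H R] [BraidedHopfAlgebra k H R] in
theorem conv_actS_act : conv (actS k H R) (act k H R) = convUnit k H _ := by
  ext h x
  have h' := congrArg (· • x) (HopfAlgebra.mul_antipode_rTensor_comul_apply (R := k) h)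
  obtain ⟨s, hs⟩ := exists_comul_eq (k := k) h
  simpa [hs, conv_apply_of_comul_eq hs, convUnit_apply, Finset.sum_smul, mul_smul, act_apply]
    using h'

end Operators

end BraidedHopf
end

/-! ### Operators on R ⊗ R that describe Δ of a product -/

noncomputable section

namespace BraidedHopf

open YetterDrinfeld

variable (k H R : Type*) [Field k] [Ring H] [HopfAlgebra k H]
    [Ring R] [Algebra k R] [Coalgebra k R] [Module H R] [IsScalarTower k H R]
    [YetterDrinfeldModule k H R] [BraidedHopfAlgebra k H R]

section Legs

/-- Operators on the first tensor factor of `R ⊗ R`. -/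
def legOne : Module.End k R →ₐ[k] Module.End k (R ⊗[k] R) := Module.End.rTensorAlgHom k R R

/-- Operators on the second tensor factor of `R ⊗ R`. -/
def legTwo : Module.End k R →ₐ[k] Module.End k (R ⊗[k] R) := Module.End.lTensorAlgHom k R R

omit [Coalgebra k R] in
@[simp] theorem legOne_tmul (e : Module.End k R) (x y : R) :
    legOne k R e (x ⊗ₜ y) = e x ⊗ₜ[k] y := rfl

omit [Coalgebra k R] in
@[simp] theorem legTwo_tmul (e : Module.End k R) (x y : R) :
    legTwo k R e (x ⊗ₜ y) = x ⊗ₜ[k] e y := rfl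

omit [Coalgebra k R] in
theorem commute_legOne_legTwo (a b : Module.End k R) : Commute (legOne k R a) (legTwo k R b) := by
  refine TensorProduct.ext' fun x y => ?_
  simp

/-- The operators `x ⊗ y ↦ r₍₋₁₎ • x ⊗ r₍₀₎ y`. -/
def braidedLm : R →ₗ[k] Module.End k (R ⊗[k] R) :=
  coactConv ((legOne k R).toLinearMap ∘ₗ act k H R) ((legTwo k R).toLinearMap ∘ₗ lm k R)

/-- The operators `x ⊗ y ↦ r₍₋₁₎ • x ⊗ S(r₍₀₎) y`. -/
def braidedLmS : R →ₗ[k] Module.End k (R ⊗[k] R) :=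
  coactConv ((legOne k R).toLinearMap ∘ₗ act k H R) ((legTwo k R).toLinearMap ∘ₗ lmS k H R)

theorem conv_legOne_lmS_lm : conv ((legOne k R).toLinearMap ∘ₗ lmS k H R)
    ((legOne k R).toLinearMap ∘ₗ lm k R) = convUnit k R _ := by
  rw [← algHom_comp_conv, conv_lmS_lm, algHom_comp_convUnit]

theorem conv_legTwo_lm_lmS : conv ((legTwo k R).toLinearMap ∘ₗ lm k R)
    ((legTwo k R).toLinearMap ∘ₗ lmS k H R) = convUnit k R _ := by
  rw [← algHom_comp_conv, conv_lm_lmS, algHom_comp_convUnit]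

theorem conv_legTwo_lmS_lm : conv ((legTwo k R).toLinearMap ∘ₗ lmS k H R)
    ((legTwo k R).toLinearMap ∘ₗ lm k R) = convUnit k R _ := by
  rw [← algHom_comp_conv, conv_lmS_lm, algHom_comp_convUnit]

omit [Coalgebra k R] [YetterDrinfeldModule k H R] [BraidedHopfAlgebra k H R] in
theorem act_mul (a b : H) : act k H R (a * b) = act k H R a * act k H R b := by
  ext x; simp [act_apply, mul_smul]

omit [Coalgebra k R] [YetterDrinfeldModule k H R] [BraidedHopfAlgebra k H R] in
theorem act_one : act k H R 1 = 1 := by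
  ext x; simp [act_apply]

omit [Coalgebra k R] [YetterDrinfeldModule k H R] [BraidedHopfAlgebra k H R] in
theorem actS_mul (a b : H) : actS k H R (a * b) = actS k H R b * actS k H R a := by
  simp [HopfAlgebra.antipode_mul_antidistrib, act_mul]

omit [Coalgebra k R] [YetterDrinfeldModule k H R] [BraidedHopfAlgebra k H R] in
theorem legOne_actS_mul (a b : H) : ((legOne k R).toLinearMap ∘ₗ actS k H R) (a * b) =
    ((legOne k R).toLinearMap ∘ₗ actS k H R) b * ((legOne k R).toLinearMap ∘ₗ actS k H R) a :=
  (congrArg (legOne k R) (actS_mul k H R a b)).trans (map_mul _ _ _)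

omit [Coalgebra k R] [YetterDrinfeldModule k H R] [BraidedHopfAlgebra k H R] in
theorem legTwo_actS_mul (a b : H) : ((legTwo k R).toLinearMap ∘ₗ actS k H R) (a * b) =
    ((legTwo k R).toLinearMap ∘ₗ actS k H R) b * ((legTwo k R).toLinearMap ∘ₗ actS k H R) a :=
  (congrArg (legTwo k R) (actS_mul k H R a b)).trans (map_mul _ _ _)

/-- The action on the first leg commutes with multiplication on the second, so `coactConv` preserves
the convolution inverse already known on the second leg. -/
theorem conv_braidedLmS_braidedLm :
    conv (braidedLmS k H R) (braidedLm k H R) = convUnit k R _ := by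
  rw [braidedLmS, braidedLm, ← coactConv_conv_of_hom, conv_legTwo_lmS_lm, coactConv_unit]
  · simp [act_one]
  · intro a b; simp [act_mul]
  · intro h x; exact commute_legOne_legTwo k R _ _

/-- The operators with `Δ(r x) = comulLm r (Δ x)`. -/
def comulLm : R →ₗ[k] Module.End k (R ⊗[k] R) :=
  conv ((legOne k R).toLinearMap ∘ₗ lm k R) (braidedLm k H R)

/-- The operators with `Δ(S(r) x) = comulLmS r (Δ x)`. -/
def comulLmS : R →ₗ[k] Module.End k (R ⊗[k] R) :=
  conv (braidedLmS k H R) ((legOne k R).toLinearMap ∘ₗ lmS k H R)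

theorem conv_comulLmS_comulLm : conv (comulLmS k H R) (comulLm k H R) = convUnit k R _ := by
  rw [comulLmS, comulLm, conv_assoc, ← conv_assoc _ _ (braidedLm k H R), conv_legOne_lmS_lm,
    convUnit_conv, conv_braidedLmS_braidedLm]

theorem comul_mul_eq (r x : R) : Coalgebra.comul (R := k) (r * x) =
    comulLm k H R r (Coalgebra.comul (R := k) x) := by
  rw [BraidedHopfAlgebra.comul_mul (k := k) (H := H)]
  obtain ⟨s, hs⟩ := exists_comul_eq (k := k) r
  rw [comulLm, conv_apply_of_comul_eq hs, hs, TensorProduct.sum_tmul, map_sum,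
    LinearMap.sum_apply]
  refine Finset.sum_congr rfl fun i _ => ?_
  generalize Coalgebra.comul (R := k) x = t
  induction t with
  | zero => simp
  | add a b ha hb => simp only [TensorProduct.tmul_add, map_add, ha, hb]
  | tmul u v =>
    obtain ⟨q, hq⟩ := exists_coact_eq (k := k) (H := H) i.2
    simp [braidedMul, braiding, braidedLm, coactConv_apply_of_coact_eq hq, hq,
      TensorProduct.sum_tmul, TensorProduct.tmul_sum]

/-- Left multiplication by S(r) is the convolution inverse of left multiplication by r, so Δ
transports it to the inverse of `comulLm`; no formula for Δ(S(r)) is needed beforehand. -/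
theorem comul_antipode_mul (r x : R) : Coalgebra.comul (R := k) (S k H R r * x) =
    comulLmS k H R r (Coalgebra.comul (R := k) x) :=
  intertwine_convInverse (Coalgebra.comul (R := k) (A := R)) (conv_lm_lmS k H R)
    (conv_comulLmS_comulLm k H R) (comul_mul_eq k H R) r x

theorem comul_smul_eq (h : H) (x : R) : Coalgebra.comul (R := k) (h • x) =
    conv ((legOne k R).toLinearMap ∘ₗ act k H R) ((legTwo k R).toLinearMap ∘ₗ act k H R) h
      (Coalgebra.comul (R := k) x) := by
  rw [BraidedHopfAlgebra.comul_smul (k := k) (H := H)]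
  obtain ⟨s, hs⟩ := exists_comul_eq (k := k) h
  rw [conv_apply_of_comul_eq hs, hs, map_sum, LinearMap.sum_apply, LinearMap.sum_apply]
  refine Finset.sum_congr rfl fun i _ => ?_
  generalize Coalgebra.comul (R := k) x = t
  induction t with
  | zero => simp
  | add a b ha hb => simp only [map_add, ha, hb]
  | tmul u v => simp [tensorAct_tmul, act_apply]

theorem comul_antipode_smul (h : H) (x : R) :
    Coalgebra.comul (R := k) (HopfAlgebra.antipode k h • x) =
    conv ((legTwo k R).toLinearMap ∘ₗ actS k H R) ((legOne k R).toLinearMap ∘ₗ actS k H R) h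
      (Coalgebra.comul (R := k) x) := by
  refine intertwine_convInverse (Coalgebra.comul (R := k) (A := R)) (P' := actS k H R)
    (conv_act_actS k H R) ?_ (comul_smul_eq k H R) h x
  rw [conv_assoc, ← conv_assoc ((legOne k R).toLinearMap ∘ₗ actS k H R), ← algHom_comp_conv,
    conv_actS_act, algHom_comp_convUnit, convUnit_conv, ← algHom_comp_conv, conv_actS_act,
    algHom_comp_convUnit]

end Legs

section BosonAntipode

/-- The operators with `Δ(κ(r) x) = comulBoson r (Δ x)`, where `κ` is `bosonAntipode`. -/
def comulBoson : R →ₗ[k] Module.End k (R ⊗[k] R) :=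
  coactConv (conv ((legTwo k R).toLinearMap ∘ₗ actS k H R)
    ((legOne k R).toLinearMap ∘ₗ actS k H R)) (comulLmS k H R)

theorem comul_bosonAntipode (r x : R) : Coalgebra.comul (R := k) (bosonAntipode k H R r x) =
    comulBoson k H R r (Coalgebra.comul (R := k) x) := by
  obtain ⟨s, hs⟩ := exists_coact_eq (k := k) (H := H) r
  simp only [bosonAntipode, comulBoson, coactConv_apply_of_coact_eq hs, LinearMap.sum_apply,
    map_sum, Module.End.mul_apply, LinearMap.comp_apply, act_apply, comul_antipode_smul]
  refine Finset.sum_congr rfl fun i _ => ?_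
  rw [← comul_antipode_mul]
  rfl

theorem legOne_comp_bosonAntipode : (legOne k R).toLinearMap ∘ₗ bosonAntipode k H R =
    coactConv ((legOne k R).toLinearMap ∘ₗ actS k H R)
      ((legOne k R).toLinearMap ∘ₗ lmS k H R) :=
  algHom_comp_coactConv _ _ _

theorem legTwo_comp_bosonAntipode : (legTwo k R).toLinearMap ∘ₗ bosonAntipode k H R =
    coactConv ((legTwo k R).toLinearMap ∘ₗ actS k H R)
      ((legTwo k R).toLinearMap ∘ₗ lmS k H R) :=
  algHom_comp_coactConv _ _ _

omit [BraidedHopfAlgebra k H R] [Coalgebra k R] in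
theorem coactConv_legOne_actS_act (G : R →ₗ[k] Module.End k (R ⊗[k] R)) :
    coactConv ((legOne k R).toLinearMap ∘ₗ actS k H R)
      (coactConv ((legOne k R).toLinearMap ∘ₗ act k H R) G) = G := by
  rw [← coactConv_conv, ← algHom_comp_conv, conv_actS_act, algHom_comp_convUnit,
    coactConv_convUnit]

omit [BraidedHopfAlgebra k H R] [Coalgebra k R] in
theorem coactConv_legTwo_act_actS (G : R →ₗ[k] Module.End k (R ⊗[k] R)) :
    coactConv ((legTwo k R).toLinearMap ∘ₗ act k H R)
      (coactConv ((legTwo k R).toLinearMap ∘ₗ actS k H R) G) = G := by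
  rw [← coactConv_conv, ← algHom_comp_conv, conv_act_actS, algHom_comp_convUnit,
    coactConv_convUnit]

/-- Acting by the antipode on the first leg undoes the `H`-action that the braiding put there, which
decouples the two legs. -/
theorem coactConv_legOne_actS_comulLmS :
    coactConv ((legOne k R).toLinearMap ∘ₗ actS k H R) (comulLmS k H R) =
      conv ((legTwo k R).toLinearMap ∘ₗ lmS k H R)
        ((legOne k R).toLinearMap ∘ₗ bosonAntipode k H R) := by
  rw [comulLmS, coactConv_conv_of_antihom, braidedLmS, coactConv_legOne_actS_act,
    legOne_comp_bosonAntipode]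
  · exact legOne_actS_mul k H R
  · intro h x
    rw [braidedLmS, coactConv_legOne_actS_act]
    exact commute_legOne_legTwo k R _ _

theorem comulBoson_eq : comulBoson k H R =
    coactConv ((legTwo k R).toLinearMap ∘ₗ actS k H R)
      (conv ((legTwo k R).toLinearMap ∘ₗ lmS k H R)
        ((legOne k R).toLinearMap ∘ₗ bosonAntipode k H R)) := by
  rw [comulBoson, coactConv_conv, coactConv_legOne_actS_comulLmS]

/-- `κ(r) x₍₁₎ ⊗ x₍₂₎` in terms of `Δ(κ(-) x)`. -/
theorem legOne_bosonAntipode_eq : (legOne k R).toLinearMap ∘ₗ bosonAntipode k H R =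
    conv ((legTwo k R).toLinearMap ∘ₗ lm k R)
      (coactConv ((legTwo k R).toLinearMap ∘ₗ act k H R) (comulBoson k H R)) := by
  rw [comulBoson_eq, coactConv_legTwo_act_actS, ← conv_assoc, conv_legTwo_lm_lmS, convUnit_conv]

/-- `x₍₁₎ ⊗ p x₍₂₎` in terms of `Δ(- x)`. -/
theorem legTwo_lm_eq_sum {ι : Type*} {s : Finset ι} {p : R} {a b : ι → R}
    (h : Coalgebra.comul (R := k) p = ∑ i ∈ s, a i ⊗ₜ[k] b i) :
    legTwo k R (lm k R p) = ∑ i ∈ s, coactConv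
      (LinearMap.mulRight k (legOne k R (bosonAntipode k H R (a i))) ∘ₗ
        (legOne k R).toLinearMap ∘ₗ actS k H R) (comulLm k H R) (b i) := by
  -- Braided form of S(p₍₁₎) p₍₂₎ x₍₁₎ ⊗ p₍₃₎ x₍₂₎ = x₍₁₎ ⊗ p x₍₂₎.
  have h1 : coactConv ((legOne k R).toLinearMap ∘ₗ actS k H R)
      (conv ((legOne k R).toLinearMap ∘ₗ lmS k H R) (comulLm k H R)) =
      (legTwo k R).toLinearMap ∘ₗ lm k R := by
    rw [comulLm, ← conv_assoc, conv_legOne_lmS_lm, convUnit_conv, braidedLm,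
      coactConv_legOne_actS_act]
  have h2 := LinearMap.congr_fun h1 p
  rw [coactConv_conv_eq_sum_of_antihom _ _ _ h, ← legOne_comp_bosonAntipode] at h2
  · exact h2.symm
  · exact legOne_actS_mul k H R

end BosonAntipode

end BraidedHopf
end

/-! ### Antipode identities of the bosonization, as operators on R -/

noncomputable section

namespace BraidedHopf

open YetterDrinfeld

variable (k H R : Type*) [Field k] [Ring H] [HopfAlgebra k H]
    [Ring R] [Algebra k R] [Coalgebra k R] [Module H R] [IsScalarTower k H R]
    [YetterDrinfeldModule k H R] [BraidedHopfAlgebra k H R]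

section Antipode

variable {k H R} in
omit [Coalgebra k R] [BraidedHopfAlgebra k H R] in
theorem braiding_tmul_of_coact_eq {ι : Type*} {s : Finset ι} {x : R} {a : ι → H} {b : ι → R}
    (hx : coact k H R x = ∑ i ∈ s, a i ⊗ₜ[k] b i) (y : R) :
    braiding k H R R (x ⊗ₜ y) = ∑ i ∈ s, (a i • y) ⊗ₜ[k] b i := by
  simp [braiding, hx, TensorProduct.sum_tmul, act_apply]

variable {k H R} in
theorem coact_antipode_eq_sum {ι : Type*} {s : Finset ι} {x : R} {a : ι → H} {b : ι → R}
    (hx : coact k H R x = ∑ i ∈ s, a i ⊗ₜ[k] b i) :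
    coact k H R (S k H R x) = ∑ i ∈ s, a i ⊗ₜ[k] S k H R (b i) := by
  simp [BraidedHopfAlgebra.antipode_coact, hx]

theorem coactConv_comp_antipode {A : Type*} [Ring A] [Algebra k A] (φ : H →ₗ[k] A)
    (G : R →ₗ[k] A) : coactConv φ G ∘ₗ S k H R = coactConv φ (G ∘ₗ S k H R) := by
  ext r
  obtain ⟨s, hs⟩ := exists_coact_eq (k := k) (H := H) r
  simp [coactConv_apply_of_coact_eq hs, coactConv_apply_of_coact_eq (coact_antipode_eq_sum hs)]

/-- The antipode is anti-comultiplicative. -/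
theorem comul_antipode (r : R) : Coalgebra.comul (R := k) (S k H R r) =
    braiding k H R R (TensorProduct.map (S k H R) (S k H R) (Coalgebra.comul (R := k) r)) := by
  -- Taking x = 1 turns the operator formula into one for Δ(S(r)).
  have h := comul_antipode_mul k H R r 1
  rw [mul_one, BraidedHopfAlgebra.comul_one (k := k) (H := H)] at h
  obtain ⟨s, hs⟩ := exists_comul_eq (k := k) r
  rw [h, comulLmS, conv_apply_of_comul_eq hs, hs, map_sum, map_sum, LinearMap.sum_apply]
  refine Finset.sum_congr rfl fun i _ => ?_
  obtain ⟨u, hu⟩ := exists_coact_eq (k := k) (H := H) i.1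
  rw [TensorProduct.map_tmul, braiding_tmul_of_coact_eq (coact_antipode_eq_sum hu), braidedLmS,
    coactConv_apply_of_coact_eq hu]
  simp [act_apply]

variable {k H R} in
theorem comul_antipode_eq_sum {ι κ : Type*} {s : Finset ι} {r : R} {a b : ι → R}
    (h : Coalgebra.comul (R := k) r = ∑ i ∈ s, a i ⊗ₜ[k] b i) {u : ι → Finset κ} {g : κ → H}
    {c : κ → R} (hu : ∀ i, coact k H R (a i) = ∑ j ∈ u i, g j ⊗ₜ[k] c j) :
    Coalgebra.comul (R := k) (S k H R r) =
      ∑ p ∈ s.sigma u, (g p.2 • S k H R (b p.1)) ⊗ₜ[k] S k H R (c p.2) := by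
  rw [comul_antipode, h, map_sum, map_sum, Finset.sum_sigma]
  refine Finset.sum_congr rfl fun i _ => ?_
  rw [TensorProduct.map_tmul, braiding_tmul_of_coact_eq (coact_antipode_eq_sum (hu i))]

theorem counit_antipode (r : R) :
    Coalgebra.counit (R := k) (S k H R r) = Coalgebra.counit (R := k) r := by
  obtain ⟨s, hs⟩ := exists_comul_eq (k := k) r
  have h := congrArg (Coalgebra.counit (R := k)) (LinearMap.congr_fun
    (BraidedHopfAlgebra.mul_antipode_rTensor_comul (k := k) (H := H) (R := R)) r)
  have h5 := congrArg (fun z => Coalgebra.counit (R := k) (S k H R (TensorProduct.rid k R z)))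
    (Coalgebra.lTensor_counit_comul (R := k) r)
  simp [hs, BraidedHopfAlgebra.counit_mul (k := k) (H := H), Algebra.algebraMap_eq_smul_one,
    BraidedHopfAlgebra.counit_one (k := k) (H := H)] at h h5
  rw [← h, ← h5]
  exact Finset.sum_congr rfl fun i _ => mul_comm _ _

/-- The map `h ↦ (x ↦ (h • y) x)`. -/
def smulLm (y : R) : H →ₗ[k] Module.End k R := lm k R ∘ₗ (act k H R).flip y

theorem conv_smulLm_act (y : R) : conv (smulLm k H R y) (act k H R) =
    LinearMap.mulRight k (lm k R y) ∘ₗ act k H R := by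
  ext h x
  obtain ⟨s, hs⟩ := exists_comul_eq (k := k) h
  simp [conv_apply_of_comul_eq hs, smulLm, act_apply,
    BraidedHopfAlgebra.smul_mul (k := k) (H := H), hs, tensorAct_tmul]

/-- This is S(h₍₁₎) • ((h₍₂₎ • y) x) = y (S(h) • x). Inserting the trivial convolution of the action
with that of the antipode on the right reduces it to the product rule for `H` acting on R. -/
theorem conv_actS_smulLm (y : R) : conv (actS k H R) (smulLm k H R y) =
    LinearMap.mulLeft k (lm k R y) ∘ₗ actS k H R := by
  have h1 : conv (actS k H R) (LinearMap.mulRight k (lm k R y) ∘ₗ act k H R) =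
      LinearMap.mulRight k (lm k R y) ∘ₗ convUnit k H _ := by
    rw [← conv_actS_act]
    ext h x
    obtain ⟨s, hs⟩ := exists_comul_eq (k := k) h
    simp [conv_apply_of_comul_eq hs]
  calc conv (actS k H R) (smulLm k H R y)
      = conv (conv (actS k H R) (smulLm k H R y)) (conv (act k H R) (actS k H R)) := by
        rw [conv_act_actS, conv_convUnit]
    _ = conv (LinearMap.mulRight k (lm k R y) ∘ₗ convUnit k H _) (actS k H R) := by
        rw [← conv_assoc, conv_assoc (actS k H R), conv_smulLm_act, h1]
    _ = LinearMap.mulLeft k (lm k R y) ∘ₗ conv (convUnit k H _) (actS k H R) := by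
        ext h x
        obtain ⟨s, hs⟩ := exists_comul_eq (k := k) h
        simp [conv_apply_of_comul_eq hs, convUnit_apply]
    _ = _ := by rw [convUnit_conv]

variable {k H R} in
/-- `κ(S(r)) x₍₁₎ ⊗ x₍₂₎` in terms of `Δ(κ(S(-)) x)`. -/
theorem legOne_bosonAntipode_antipode_eq_sum {ι : Type*} {s : Finset ι} {r : R} {a b : ι → R}
    (h : Coalgebra.comul (R := k) r = ∑ i ∈ s, a i ⊗ₜ[k] b i) :
    legOne k R (bosonAntipode k H R (S k H R r)) = ∑ i ∈ s, coactConv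
      (LinearMap.mulRight k (legTwo k R (lmS k H R (b i))) ∘ₗ
        (legTwo k R).toLinearMap ∘ₗ act k H R) (comulBoson k H R ∘ₗ S k H R) (a i) := by
  choose u hu using fun i => exists_coact_eq (k := k) (H := H) (a i)
  have h1 := LinearMap.congr_fun (legOne_bosonAntipode_eq k H R) (S k H R r)
  rw [conv_apply_of_comul_eq (comul_antipode_eq_sum h hu), Finset.sum_sigma] at h1
  refine h1.trans (Finset.sum_congr rfl fun i _ => ?_)
  -- The product rule moves the action created by the braiding in Δ(S(r)) outside the multiplication
  -- by S(r₍₂₎).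
  have h2 : conv ((legTwo k R).toLinearMap ∘ₗ smulLm k H R (S k H R (b i)))
      ((legTwo k R).toLinearMap ∘ₗ act k H R) =
      LinearMap.mulRight k (legTwo k R (lmS k H R (b i))) ∘ₗ
        (legTwo k R).toLinearMap ∘ₗ act k H R := by
    rw [← algHom_comp_conv, conv_smulLm_act]
    ext1 x
    simp
  rw [← h2, coactConv_conv, ← coactConv_comp_antipode, coactConv_apply_of_coact_eq (hu i)]
  rfl

end Antipode

section BosonInverse

variable {k H R} in
theorem coactConv_comp_comul_of_antihom {A : Type*} [Ring A] [Algebra k A] {φ : H →ₗ[k] A}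
    (hφ : ∀ a b, φ (a * b) = φ b * φ a) (T : R ⊗[k] R →ₗ[k] A)
    {ι κ : Type*} {s : Finset ι} {r : R} {a b : ι → R}
    (h : Coalgebra.comul (R := k) r = ∑ i ∈ s, a i ⊗ₜ[k] b i) {u : ι → Finset κ} {g : κ → H}
    {c : κ → R} (hu : ∀ i, coact k H R (b i) = ∑ j ∈ u i, g j ⊗ₜ[k] c j) :
    coactConv φ (T ∘ₗ Coalgebra.comul) r = ∑ i ∈ s, ∑ j ∈ u i,
      φ (g j) * coactConv φ (T ∘ₗ (TensorProduct.mk k R R).flip (c j)) (a i) := by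
  have h1 : ∀ t : H ⊗[k] R,
      LinearMap.mul' k A (TensorProduct.map φ (T ∘ₗ Coalgebra.comul) t) =
      LinearMap.mul' k A (TensorProduct.map φ T (Coalgebra.comul.lTensor H t)) := by
    intro t
    induction t with
    | zero => simp
    | add a b ha hb => simp only [map_add, ha, hb]
    | tmul a c => simp
  rw [coactConv_apply, h1, BraidedHopfAlgebra.comul_coact, h, map_sum, map_sum, map_sum]
  refine Finset.sum_congr rfl fun i _ => ?_
  obtain ⟨s', hs'⟩ := exists_coact_eq (k := k) (H := H) (a i)
  rw [tensorCoact_tmul_eq_sum hs' (hu i), Finset.sum_comm]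
  simp [coactConv_apply_of_coact_eq hs', hφ, Finset.mul_sum, mul_assoc]

-- One computation for both antipode identities, with (F, G) equal to (id, S) or (S, id). Evaluate G
-- ⋆ F = ε at S(r), where Δ(S(r)) = c(S ⊗ S)Δ(r), and apply S(r₍₋₁₎); the result factors as
-- κ(G(r₍₂₎)) κ(F(r₍₁₎)).
variable {k H R} in
theorem sum_bosonAntipode_mul_bosonAntipode {F G : R →ₗ[k] R}
    (hF : ∀ x, coact k H R (F x) = F.lTensor H (coact k H R x))
    (hG : ∀ x, coact k H R (G x) = G.lTensor H (coact k H R x))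
    (hFS : ∀ x, F (S k H R x) = S k H R (F x))
    (hGS : ∀ (h : H) x, G (h • S k H R x) = h • S k H R (G x))
    (hGF : conv G F = convUnit k R R)
    {ι : Type*} {s : Finset ι} {r : R} {a b : ι → R}
    (h : Coalgebra.comul (R := k) r = ∑ i ∈ s, a i ⊗ₜ[k] b i) :
    ∑ i ∈ s, bosonAntipode k H R (G (b i)) * bosonAntipode k H R (F (a i)) =
      Coalgebra.counit (R := k) r • 1 := by
  choose u hu using fun i => exists_coact_eq (k := k) (H := H) (b i)
  let T : R ⊗[k] R →ₗ[k] Module.End k R := lm k R ∘ₗ LinearMap.mul' k R ∘ₗ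
    TensorProduct.map G F ∘ₗ braiding k H R R ∘ₗ TensorProduct.map (S k H R) (S k H R)
  have hT : T ∘ₗ Coalgebra.comul = convUnit k R _ := by
    ext x z
    have h1 := LinearMap.congr_fun hGF (S k H R x)
    simp only [conv, LinearMap.comp_apply, comul_antipode, convUnit_apply, counit_antipode] at h1
    simp [T, h1, convUnit_apply]
  have h1 : ∀ y : R, T ∘ₗ (TensorProduct.mk k R R).flip y =
      coactConv (smulLm k H R (S k H R (G y))) (lmS k H R ∘ₗ F) := by
    intro y
    ext x z
    obtain ⟨v, hv⟩ := exists_coact_eq (k := k) (H := H) x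
    simp [T, braiding_tmul_of_coact_eq (coact_antipode_eq_sum hv), coactConv_apply_of_coact_eq hv,
      hGS, hFS, smulLm, act_apply, mul_assoc]
  have h2 : coactConv (actS k H R) (convUnit k R _) r = Coalgebra.counit (R := k) r • 1 := by
    rw [coactConv_unit, convUnit_apply]
    simp [act_one]
  rw [← h2, ← hT, coactConv_comp_comul_of_antihom (actS_mul k H R) T h hu]
  refine Finset.sum_congr rfl fun i _ => ?_
  have hGb : coact k H R (G (b i)) = ∑ j ∈ u i, j.1 ⊗ₜ[k] G j.2 := by
    rw [hG, hu i]; simp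
  have hFa : bosonAntipode k H R (F (a i)) = coactConv (actS k H R) (lmS k H R ∘ₗ F) (a i) := by
    obtain ⟨v, hv⟩ := exists_coact_eq (k := k) (H := H) (a i)
    have hFv : coact k H R (F (a i)) = ∑ j ∈ v, j.1 ⊗ₜ[k] F j.2 := by
      rw [hF, hv]; simp
    rw [bosonAntipode, coactConv_apply_of_coact_eq hv, coactConv_apply_of_coact_eq hFv]
    rfl
  rw [hFa, bosonAntipode, coactConv_apply_of_coact_eq hGb, Finset.sum_mul]
  refine Finset.sum_congr rfl fun j _ => ?_
  rw [mul_assoc, h1, ← coactConv_conv, conv_actS_smulLm]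
  congr 1
  obtain ⟨v, hv⟩ := exists_coact_eq (k := k) (H := H) (a i)
  simp [coactConv_apply_of_coact_eq hv, Finset.mul_sum, mul_assoc]

variable {k H R} in
theorem sum_bosonAntipode_antipode_mul {ι : Type*} {s : Finset ι} {r : R} {a b : ι → R}
    (h : Coalgebra.comul (R := k) r = ∑ i ∈ s, a i ⊗ₜ[k] b i) :
    ∑ i ∈ s, bosonAntipode k H R (S k H R (b i)) * bosonAntipode k H R (a i) =
      Coalgebra.counit (R := k) r • 1 := by
  refine sum_bosonAntipode_mul_bosonAntipode (F := LinearMap.id) (G := S k H R) (by simp)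
    BraidedHopfAlgebra.antipode_coact (fun _ => rfl)
    (fun h x => BraidedHopfAlgebra.antipode_smul _ _) ?_ h
  exact BraidedHopfAlgebra.mul_antipode_rTensor_comul

variable {k H R} in
theorem sum_bosonAntipode_mul_antipode {ι : Type*} {s : Finset ι} {r : R} {a b : ι → R}
    (h : Coalgebra.comul (R := k) r = ∑ i ∈ s, a i ⊗ₜ[k] b i) :
    ∑ i ∈ s, bosonAntipode k H R (b i) * bosonAntipode k H R (S k H R (a i)) =
      Coalgebra.counit (R := k) r • 1 := by
  refine sum_bosonAntipode_mul_bosonAntipode (F := S k H R) (G := LinearMap.id)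
    BraidedHopfAlgebra.antipode_coact (by simp) (fun _ => rfl) (fun h x => rfl) ?_ h
  exact BraidedHopfAlgebra.mul_antipode_lTensor_comul

end BosonInverse

end BraidedHopf
end

/-! ### The square of the antipode of the bosonization -/

noncomputable section

namespace BraidedHopf

open YetterDrinfeld

variable (k H R : Type*) [Field k] [Ring H] [HopfAlgebra k H]
    [Ring R] [Algebra k R] [Coalgebra k R] [Module H R] [IsScalarTower k H R]
    [YetterDrinfeldModule k H R] [BraidedHopfAlgebra k H R]

section Twist

-- Coassociativity turns two successive coactions into Δ(v₍₋₁₎), which `M` collapses. In the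
-- applications the hypothesis on `M` is an antipode identity of `H`.
variable {k H R} in
omit [Coalgebra k R] [BraidedHopfAlgebra k H R] in
theorem sum_coact_coact_eq {M : H ⊗[k] H →ₗ[k] H}
    (hM : ∀ h, M (Coalgebra.comul (R := k) h) = Coalgebra.counit (R := k) h • 1)
    {ι κ : Type*} {s : Finset ι} {v : R} {a : ι → H} {b : ι → R}
    (hv : coact k H R v = ∑ i ∈ s, a i ⊗ₜ[k] b i) {u : ι → Finset κ} {g : κ → H}
    {c : κ → R} (hu : ∀ i, coact k H R (b i) = ∑ j ∈ u i, g j ⊗ₜ[k] c j) :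
    ∑ i ∈ s, ∑ j ∈ u i, M (a i ⊗ₜ g j) ⊗ₜ[k] c j = 1 ⊗ₜ[k] v := by
  have h1 := congrArg (fun z => M.rTensor R ((TensorProduct.assoc k H H R).symm z))
    (LinearMap.congr_fun (LeftComodule.coassoc (k := k) (C := H) (V := R)) v)
  have h2 := congrArg (fun z => (1 : H) ⊗ₜ[k] TensorProduct.lid k R z)
    (LinearMap.congr_fun (LeftComodule.counit_coact (k := k) (C := H) (V := R)) v)
  simp only [LinearMap.comp_apply, hv, hu, map_sum, LinearMap.lTensor_tmul, LinearMap.rTensor_tmul,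
    LinearEquiv.coe_coe, LinearEquiv.symm_apply_apply, TensorProduct.tmul_sum, hM,
    TensorProduct.assoc_symm_tmul, TensorProduct.lid_tmul, TensorProduct.mk_apply, one_smul]
    at h1 h2
  rw [← h1, ← h2]
  exact Finset.sum_congr rfl fun i _ => TensorProduct.smul_tmul _ _ _

/-- The map `v ↦ f(v₍₋₁₎) • v₍₀₎`. -/
def twistBy (f : H →ₗ[k] H) : R →ₗ[k] R := TensorProduct.lift (act k H R ∘ₗ f) ∘ₗ coact k H R

variable {k H R} in
omit [Coalgebra k R] [BraidedHopfAlgebra k H R] in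
theorem twistBy_eq_sum (f : H →ₗ[k] H) {ι : Type*} {s : Finset ι} {v : R} {a : ι → H} {b : ι → R}
    (hv : coact k H R v = ∑ i ∈ s, a i ⊗ₜ[k] b i) :
    twistBy k H R f v = ∑ i ∈ s, f (a i) • b i := by
  simp [twistBy, hv, act_apply]

-- The Yetter-Drinfeld condition gives S(h₍₁₎ v₍₋₁₎ S(h₍₃₎)) h₍₂₎ = S²(h₍₃₎) S(v₍₋₁₎) S(h₍₁₎) h₍₂₎,
-- and the last two factors collapse.
omit [Coalgebra k R] [BraidedHopfAlgebra k H R] in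
theorem twistBy_antipode_smul (h : H) (v : R) :
    twistBy k H R (HopfAlgebra.antipode k) (h • v) =
      HopfAlgebra.antipode k (HopfAlgebra.antipode k h) •
        twistBy k H R (HopfAlgebra.antipode k) v := by
  obtain ⟨s, hs⟩ := exists_coact_eq (k := k) (H := H) v
  have h1 : ∀ (x : H) (w : R) (u : H ⊗[k] H),
      TensorProduct.lift (actS k H R) (twist k H R (TensorProduct.assoc k H H H
        ((Coalgebra.comul (R := k)).rTensor H u)) (x ⊗ₜ[k] w)) =
      HopfAlgebra.antipode k (HopfAlgebra.antipode k (TensorProduct.lid k H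
        ((Coalgebra.counit (R := k)).rTensor H u))) • HopfAlgebra.antipode k x • w := by
    intro x w u
    induction u with
    | zero => simp
    | add a b ha hb => simp only [map_add, LinearMap.add_apply, ha, hb, add_smul]
    | tmul y z =>
      obtain ⟨t, ht⟩ := exists_comul_eq (k := k) y
      have hS := HopfAlgebra.mul_antipode_rTensor_comul_apply (R := k) y
      simp only [ht, map_sum, LinearMap.rTensor_tmul, LinearMap.mul'_apply] at hS
      have h2 : ∀ i : H × H, HopfAlgebra.antipode k (i.1 * x * HopfAlgebra.antipode k z) • i.2 • w =
          (HopfAlgebra.antipode k (HopfAlgebra.antipode k z) * HopfAlgebra.antipode k x *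
            (HopfAlgebra.antipode k i.1 * i.2)) • w := by
        intro i
        simp [HopfAlgebra.antipode_mul_antidistrib, mul_smul]
      simp only [LinearMap.rTensor_tmul, ht, TensorProduct.sum_tmul, map_sum,
        LinearMap.sum_apply, TensorProduct.assoc_tmul, twist_tmul, TensorProduct.lift.tmul,
        LinearMap.comp_apply, act_apply, h2, ← Finset.sum_smul, ← Finset.mul_sum, hS,
        TensorProduct.lid_tmul, map_smul]
      simp [Algebra.algebraMap_eq_smul_one, mul_smul]
  have h3 : twistBy k H R (HopfAlgebra.antipode k) (h • v) = TensorProduct.lift (actS k H R)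
      (coact k H R (h • v)) := rfl
  rw [h3, YetterDrinfeldModule.coact_smul, ← Coalgebra.coassoc_apply, twistBy_eq_sum _ hs,
    show LeftComodule.coact v = _ from hs, map_sum, map_sum, Finset.smul_sum]
  refine Finset.sum_congr rfl fun i _ => ?_
  rw [h1, Coalgebra.rTensor_counit_comul, TensorProduct.lid_tmul, one_smul]

variable {k H} in
/-- The inverse of a bijective antipode. -/
def antipodeInv (hH : Function.Bijective (HopfAlgebra.antipode k (A := H))) : H →ₗ[k] H :=
  (LinearEquiv.ofBijective _ hH).symm.toLinearMap

variable {k H}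
variable (hH : Function.Bijective (HopfAlgebra.antipode k (A := H)))

theorem antipode_antipodeInv (h : H) : HopfAlgebra.antipode k (antipodeInv hH h) = h :=
  (LinearEquiv.ofBijective _ hH).apply_symm_apply h

theorem antipodeInv_antipode (h : H) : antipodeInv hH (HopfAlgebra.antipode k h) = h :=
  (LinearEquiv.ofBijective _ hH).symm_apply_apply h

theorem antipodeInv_mul (a b : H) :
    antipodeInv hH (a * b) = antipodeInv hH b * antipodeInv hH a := by
  apply hH.1
  simp [antipode_antipodeInv, HopfAlgebra.antipode_mul_antidistrib]

theorem sum_antipodeInv_mul {s : Finset (H × H)} {h : H}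
    (hs : Coalgebra.comul (R := k) h = ∑ i ∈ s, i.1 ⊗ₜ[k] i.2) :
    ∑ i ∈ s, antipodeInv hH i.2 * i.1 = Coalgebra.counit (R := k) h • 1 := by
  apply hH.1
  have hS := HopfAlgebra.mul_antipode_rTensor_comul_apply (R := k) h
  simpa [hs, antipode_antipodeInv, HopfAlgebra.antipode_mul_antidistrib,
    Algebra.algebraMap_eq_smul_one] using hS

-- As S⁻² is multiplicative, the acting element is S⁻²(h₍₁₎) S⁻²(v₍₋₁₎) S⁻¹(h₍₃₎) h₍₂₎, and the last
-- two factors collapse.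
omit [Coalgebra k R] [BraidedHopfAlgebra k H R] in
theorem twistBy_antipodeInv_smul (h : H) (v : R) :
    twistBy k H R (antipodeInv hH ∘ₗ antipodeInv hH) (h • v) =
      antipodeInv hH (antipodeInv hH h) •
        twistBy k H R (antipodeInv hH ∘ₗ antipodeInv hH) v := by
  obtain ⟨s, hs⟩ := exists_coact_eq (k := k) (H := H) v
  have h1 : ∀ (x : H) (w : R) (u : H ⊗[k] H),
      TensorProduct.lift (act k H R ∘ₗ antipodeInv hH ∘ₗ antipodeInv hH) (twist k H R
        ((Coalgebra.comul (R := k)).lTensor H u) (x ⊗ₜ[k] w)) =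
      antipodeInv hH (antipodeInv hH (TensorProduct.rid k H
        ((Coalgebra.counit (R := k)).lTensor H u))) • antipodeInv hH (antipodeInv hH x) • w := by
    intro x w u
    induction u with
    | zero => simp
    | add a b ha hb => simp only [map_add, LinearMap.add_apply, ha, hb, add_smul]
    | tmul y z =>
      obtain ⟨t, ht⟩ := exists_comul_eq (k := k) z
      have h2 : ∀ i : H × H,
          antipodeInv hH (antipodeInv hH (y * x * HopfAlgebra.antipode k i.2)) • i.1 • w =
          (antipodeInv hH (antipodeInv hH y) * antipodeInv hH (antipodeInv hH x) *
            (antipodeInv hH i.2 * i.1)) • w := by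
        intro i
        simp [antipodeInv_mul, antipodeInv_antipode, mul_smul]
      simp only [LinearMap.lTensor_tmul, ht, TensorProduct.tmul_sum, map_sum,
        LinearMap.sum_apply, twist_tmul, TensorProduct.lift.tmul,
        LinearMap.comp_apply, act_apply, h2, ← Finset.sum_smul, ← Finset.mul_sum,
        sum_antipodeInv_mul hH ht, TensorProduct.rid_tmul, map_smul]
      simp [mul_smul]
  have h3 : twistBy k H R (antipodeInv hH ∘ₗ antipodeInv hH) (h • v) =
      TensorProduct.lift (act k H R ∘ₗ antipodeInv hH ∘ₗ antipodeInv hH)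
      (coact k H R (h • v)) := rfl
  rw [h3, YetterDrinfeldModule.coact_smul, twistBy_eq_sum _ hs,
    show LeftComodule.coact v = _ from hs, map_sum, map_sum, Finset.smul_sum]
  refine Finset.sum_congr rfl fun i _ => ?_
  rw [h1, Coalgebra.lTensor_counit_comul, TensorProduct.rid_tmul, one_smul]
  rfl

omit [Coalgebra k R] [BraidedHopfAlgebra k H R] in
include hH in
theorem bijective_twistBy_antipode :
    Function.Bijective (twistBy k H R (HopfAlgebra.antipode k)) := by
  -- The inverse is v ↦ S⁻²(v₍₋₁₎) • v₍₀₎. Semilinearity over S⁻² and S² reduces the two composites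
  -- to S⁻¹(S⁻¹(h₍₂₎) h₍₁₎) = ε(h) and h₍₁₎ S(h₍₂₎) = ε(h).
  refine Function.bijective_iff_has_inverse.2
    ⟨twistBy k H R (antipodeInv hH ∘ₗ antipodeInv hH), fun v => ?_, fun v => ?_⟩
  · obtain ⟨s, hs⟩ := exists_coact_eq (k := k) (H := H) v
    choose u hu using fun i : H × R => exists_coact_eq (k := k) (H := H) i.2
    have h1 := congrArg (TensorProduct.lift (act k H R)) (sum_coact_coact_eq
      (M := antipodeInv hH ∘ₗ LinearMap.mul' k H ∘ₗ (antipodeInv hH).rTensor H ∘ₗ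
        (TensorProduct.comm k H H).toLinearMap) (fun h => by
        obtain ⟨t, ht⟩ := exists_comul_eq (k := k) h
        have h2 := congrArg (antipodeInv hH) (sum_antipodeInv_mul hH ht)
        have h3 : antipodeInv hH 1 = 1 := hH.1 (by simp [antipode_antipodeInv])
        simpa [ht, h3] using h2) hs hu)
    rw [twistBy_eq_sum _ hs, map_sum]
    simpa [twistBy_antipodeInv_smul, twistBy_eq_sum _ (hu _), antipodeInv_antipode,
      antipodeInv_mul, act_apply, mul_smul, Finset.smul_sum] using h1
  · obtain ⟨s, hs⟩ := exists_coact_eq (k := k) (H := H) v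
    choose u hu using fun i : H × R => exists_coact_eq (k := k) (H := H) i.2
    have h1 := congrArg (TensorProduct.lift (act k H R)) (sum_coact_coact_eq
      (M := LinearMap.mul' k H ∘ₗ (HopfAlgebra.antipode k).lTensor H) (fun h => by
        simp [Algebra.algebraMap_eq_smul_one]) hs hu)
    rw [twistBy_eq_sum _ hs, map_sum]
    simpa [twistBy_antipode_smul, twistBy_eq_sum _ (hu _), antipode_antipodeInv, act_apply,
      mul_smul, Finset.smul_sum] using h1

end Twist

section Square

variable {k H}

/-- The square of the antipode of the bosonization of `R`, restricted to `R`. -/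
def bosonSquare : R →ₗ[k] R :=
  twistBy k H R (HopfAlgebra.antipode k) ∘ₗ S k H R ∘ₗ S k H R

theorem bijective_bosonSquare (hH : Function.Bijective (HopfAlgebra.antipode k (A := H)))
    (hR : Function.Bijective (S k H R)) : Function.Bijective (bosonSquare (k := k) (H := H) R) :=
  (bijective_twistBy_antipode R hH).comp (hR.comp hR)

theorem bosonAntipode_one (r : R) : bosonAntipode k H R r 1 =
    twistBy k H R (HopfAlgebra.antipode k) (S k H R r) := by
  obtain ⟨s, hs⟩ := exists_coact_eq (k := k) (H := H) r
  simp [bosonAntipode, coactConv_apply_of_coact_eq hs, twistBy_eq_sum _ (coact_antipode_eq_sum hs),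
    act_apply]

theorem bosonSquare_eq (r : R) :
    bosonSquare (k := k) (H := H) R r = bosonAntipode k H R (S k H R r) 1 := by
  rw [bosonAntipode_one]; rfl

theorem bosonAntipode_smul_one (h : H) (r : R) : bosonAntipode k H R (h • r) 1 =
    HopfAlgebra.antipode k (HopfAlgebra.antipode k h) • bosonAntipode k H R r 1 := by
  rw [bosonAntipode_one, bosonAntipode_one, BraidedHopfAlgebra.antipode_smul,
    twistBy_antipode_smul]

/-- Like an antipode, r ↦ κ(r) 1 reverses the coproduct, up to an action of `H` left over from the
braiding. -/
theorem comul_bosonAntipode_one {ι κ : Type*} {s : Finset ι} {r : R} {a b : ι → R}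
    (h : Coalgebra.comul (R := k) r = ∑ i ∈ s, a i ⊗ₜ[k] b i) {u : ι → Finset κ} {g : κ → H}
    {c : κ → R} (hu : ∀ i, coact k H R (b i) = ∑ j ∈ u i, g j ⊗ₜ[k] c j) :
    Coalgebra.comul (R := k) (bosonAntipode k H R r 1) = ∑ i ∈ s, ∑ j ∈ u i,
      bosonAntipode k H R (c j) 1 ⊗ₜ[k]
        (HopfAlgebra.antipode k (g j) • bosonAntipode k H R (a i) 1) := by
  rw [comul_bosonAntipode, BraidedHopfAlgebra.comul_one (k := k) (H := H), comulBoson_eq,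
    coactConv_conv_eq_sum_of_antihom (legTwo_actS_mul k H R) _ _ h, ← legTwo_comp_bosonAntipode,
    LinearMap.sum_apply]
  refine Finset.sum_congr rfl fun i _ => ?_
  simp [coactConv_apply_of_coact_eq (hu i), act_apply]

/-- Both S and κ(-) 1 reverse the coproduct, and their leftover `H`-actions combine to S(S(h₍₁₎)
h₍₂₎) = ε(h). -/
theorem comul_bosonSquare (r : R) : Coalgebra.comul (R := k) (bosonSquare (k := k) (H := H) R r) =
    TensorProduct.map (bosonSquare (k := k) (H := H) R) (bosonSquare (k := k) (H := H) R)
      (Coalgebra.comul (R := k) r) := by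
  obtain ⟨s, hs⟩ := exists_comul_eq (k := k) r
  choose u hu using fun x : R => exists_coact_eq (k := k) (H := H) x
  rw [bosonSquare_eq, comul_bosonAntipode_one R (comul_antipode_eq_sum hs fun i => hu i.1)
    (fun p => coact_antipode_eq_sum (hu p.2.2)), hs, map_sum, Finset.sum_sigma]
  refine Finset.sum_congr rfl fun i _ => ?_
  have h1 := sum_coact_coact_eq (M := HopfAlgebra.antipode k ∘ₗ
    LinearMap.mul' k H ∘ₗ (HopfAlgebra.antipode k).rTensor H) (fun h => by
        simp [Algebra.algebraMap_eq_smul_one]) (hu i.1) (fun j => hu j.2)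
  have h2 := congrArg ((TensorProduct.comm k R R).toLinearMap ∘ₗ TensorProduct.map
    ((act k H R).flip (bosonSquare (k := k) (H := H) R i.2)) (bosonSquare (k := k) (H := H) R)) h1
  simpa [bosonAntipode_smul_one, act_apply, HopfAlgebra.antipode_mul_antidistrib, mul_smul,
    ← bosonSquare_eq] using h2

end Square

end BraidedHopf
end

noncomputable section

/-! ### The actions of the dual algebra on a coalgebra -/

namespace CoalgebraDual

variable {k C : Type*} [Field k] [AddCommGroup C] [Module k C]

/-- Reduces identities in C ⊗ C to associativity of the convolution of functionals. -/
theorem tensor_ext_dual {t t' : C ⊗[k] C} (h : ∀ a b : C →ₗ[k] k,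
    LinearMap.mul' k k (TensorProduct.map a b t) = LinearMap.mul' k k (TensorProduct.map a b t')) :
    t = t' := by
  let e := Module.Basis.ofVectorSpace k C
  have h1 : ∀ (t : C ⊗[k] C) i j, (e.tensorProduct e).repr t (i, j) =
      LinearMap.mul' k k (TensorProduct.map (e.coord i) (e.coord j) t) := by
    intro t i j
    induction t with
    | zero => simp
    | add x y hx hy => simp only [map_add, Finsupp.add_apply, hx, hy]
    | tmul x y => simp [mul_comm]
  refine (e.tensorProduct e).ext_elem fun p => ?_
  rw [h1 t p.1 p.2, h1 t' p.1 p.2, h]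

theorem dual_ext {x y : C} (h : ∀ a : C →ₗ[k] k, a x = a y) : x = y := by
  rw [← sub_eq_zero, ← Module.forall_dual_apply_eq_zero_iff k]
  intro a
  rw [map_sub, h, sub_self]

variable [Coalgebra k C]

/-- The map `x ↦ x₍₁₎ f(x₍₂₎)`. -/
def contractRight (f : C →ₗ[k] k) : C →ₗ[k] C :=
  (TensorProduct.rid k C).toLinearMap ∘ₗ f.lTensor C ∘ₗ Coalgebra.comul

/-- The map `x ↦ f(x₍₁₎) x₍₂₎`. -/
def contractLeft (f : C →ₗ[k] k) : C →ₗ[k] C :=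
  (TensorProduct.lid k C).toLinearMap ∘ₗ f.rTensor C ∘ₗ Coalgebra.comul

theorem apply_contractRight (a f : C →ₗ[k] k) (x : C) : a (contractRight f x) = conv a f x := by
  obtain ⟨s, hs⟩ := exists_comul_eq (k := k) x
  simp [contractRight, hs, conv_apply_of_comul_eq hs, mul_comm]

theorem apply_contractLeft (a f : C →ₗ[k] k) (x : C) : a (contractLeft f x) = conv f a x := by
  obtain ⟨s, hs⟩ := exists_comul_eq (k := k) x
  simp [contractLeft, hs, conv_apply_of_comul_eq hs]

theorem contractRight_conv (f g : C →ₗ[k] k) (x : C) :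
    contractRight (conv f g) x = contractRight f (contractRight g x) :=
  dual_ext fun a => by
    rw [apply_contractRight, apply_contractRight, apply_contractRight, conv_assoc]

theorem contractLeft_conv (f g : C →ₗ[k] k) (x : C) :
    contractLeft (conv f g) x = contractLeft g (contractLeft f x) :=
  dual_ext fun a => by
    rw [apply_contractLeft, apply_contractLeft, apply_contractLeft, conv_assoc]

theorem contractRight_contractLeft (f g : C →ₗ[k] k) (x : C) :
    contractRight f (contractLeft g x) = contractLeft g (contractRight f x) :=
  dual_ext fun a => by
    rw [apply_contractRight, apply_contractLeft, apply_contractLeft, apply_contractRight,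
      conv_assoc]

theorem conv_counit (f : C →ₗ[k] k) : conv f Coalgebra.counit = f := conv_convUnit f

theorem counit_conv (f : C →ₗ[k] k) : conv Coalgebra.counit f = f := convUnit_conv f

theorem contractRight_counit (x : C) : contractRight (Coalgebra.counit (R := k)) x = x :=
  dual_ext fun a => by rw [apply_contractRight, conv_counit]

theorem contractLeft_counit (x : C) : contractLeft (Coalgebra.counit (R := k)) x = x :=
  dual_ext fun a => by rw [apply_contractLeft, counit_conv]

theorem IsSubcoalgebra.contractRight_mem {D : Submodule k C} (hD : IsSubcoalgebra k D)
    (f : C →ₗ[k] k) {x : C} (hx : x ∈ D) : contractRight f x ∈ D := by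
  have h : tensorSubspace k D D ≤
      D.comap ((TensorProduct.rid k C).toLinearMap ∘ₗ f.lTensor C) :=
    Submodule.map₂_le.2 fun a ha b _ => by simpa using D.smul_mem _ ha
  exact h (hD hx)

theorem IsSubcoalgebra.contractLeft_mem {D : Submodule k C} (hD : IsSubcoalgebra k D)
    (f : C →ₗ[k] k) {x : C} (hx : x ∈ D) : contractLeft f x ∈ D := by
  have h : tensorSubspace k D D ≤
      D.comap ((TensorProduct.lid k C).toLinearMap ∘ₗ f.rTensor C) :=
    Submodule.map₂_le.2 fun a _ b hb => by simpa using D.smul_mem _ hb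
  exact h (hD hx)

/-- For a projection P onto D, the two stabilities allow P to be inserted in either leg of Δ(x), so
Δ(x) = (P ⊗ P)Δ(x). -/
theorem isSubcoalgebra_of_contract_mem {D : Submodule k C}
    (hr : ∀ f : C →ₗ[k] k, ∀ x ∈ D, contractRight f x ∈ D)
    (hl : ∀ f : C →ₗ[k] k, ∀ x ∈ D, contractLeft f x ∈ D) : IsSubcoalgebra k D := by
  obtain ⟨q, hq⟩ := D.subtype.exists_leftInverse_of_injective D.ker_subtype
  have hP : ∀ x ∈ D, D.subtype (q x) = x := fun x hx =>
    congrArg Subtype.val (LinearMap.congr_fun hq ⟨x, hx⟩)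
  intro x hx
  have h1 : Coalgebra.comul (R := k) x =
      TensorProduct.map (D.subtype ∘ₗ q) (D.subtype ∘ₗ q) (Coalgebra.comul (R := k) x) := by
    refine tensor_ext_dual fun a b => ?_
    change _ = LinearMap.mul' k k ((TensorProduct.map a b ∘ₗ
      TensorProduct.map (D.subtype ∘ₗ q) (D.subtype ∘ₗ q)) (Coalgebra.comul (R := k) x))
    rw [← TensorProduct.map_comp]
    change conv a b x = conv (a ∘ₗ D.subtype ∘ₗ q) (b ∘ₗ D.subtype ∘ₗ q) x
    rw [← apply_contractRight, ← apply_contractRight]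
    simp only [LinearMap.comp_apply]
    rw [hP _ (hr _ _ hx), apply_contractRight, apply_contractRight, ← apply_contractLeft,
      ← apply_contractLeft]
    simp only [LinearMap.comp_apply]
    rw [hP _ (hl _ _ hx)]
  rw [Submodule.mem_comap, h1]
  generalize Coalgebra.comul (R := k) x = t
  induction t with
  | zero => simp
  | add x y hx hy => rw [map_add]; exact Submodule.add_mem _ hx hy
  | tmul x y => exact Submodule.apply_mem_map₂ _ (q x).2 (q y).2

variable (k C) in
/-- The algebra of operators on `C` generated by the two actions of the dual algebra. -/
def contractAlgebra : Subalgebra k (Module.End k C) :=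
  Algebra.adjoin k (Set.range contractRight ∪ Set.range contractLeft)

theorem contractRight_mem (f : C →ₗ[k] k) : contractRight f ∈ contractAlgebra k C :=
  Algebra.subset_adjoin (Or.inl ⟨f, rfl⟩)

theorem contractLeft_mem (f : C →ₗ[k] k) : contractLeft f ∈ contractAlgebra k C :=
  Algebra.subset_adjoin (Or.inr ⟨f, rfl⟩)

/-- A subspace stable under both actions of the dual algebra, as a submodule. -/
def contractSubmodule (D : Submodule k C)
    (hr : ∀ f : C →ₗ[k] k, ∀ x ∈ D, contractRight f x ∈ D)
    (hl : ∀ f : C →ₗ[k] k, ∀ x ∈ D, contractLeft f x ∈ D) :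
    Submodule (contractAlgebra k C) C where
  carrier := D
  add_mem' := D.add_mem
  zero_mem' := D.zero_mem
  smul_mem' := by
    rintro ⟨e, he⟩ x hx
    change e x ∈ D
    induction he using Algebra.adjoin_induction generalizing x with
    | mem e he =>
      rcases he with ⟨f, rfl⟩ | ⟨f, rfl⟩
      · exact hr f x hx
      · exact hl f x hx
    | algebraMap c => exact D.smul_mem c hx
    | add a b _ _ ha hb => exact D.add_mem (ha hx) (hb hx)
    | mul a b _ _ ha hb => exact ha (hb hx)

theorem contractRight_mem_of_mem (M : Submodule (contractAlgebra k C) C) (f : C →ₗ[k] k) {x : C}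
    (hx : x ∈ M) : contractRight f x ∈ M :=
  M.smul_mem ⟨contractRight f, contractRight_mem f⟩ hx

theorem contractLeft_mem_of_mem (M : Submodule (contractAlgebra k C) C) (f : C →ₗ[k] k) {x : C}
    (hx : x ∈ M) : contractLeft f x ∈ M :=
  M.smul_mem ⟨contractLeft f, contractLeft_mem f⟩ hx

theorem isSubcoalgebra_restrictScalars (M : Submodule (contractAlgebra k C) C) :
    IsSubcoalgebra k (M.restrictScalars k) :=
  isSubcoalgebra_of_contract_mem (fun f _ hx => contractRight_mem_of_mem M f hx)
    (fun f _ hx => contractLeft_mem_of_mem M f hx)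

/-- Every element of a coalgebra lies in a finite-dimensional subcoalgebra. -/
theorem exists_finiteDimensional_submodule (c : C) : ∃ M : Submodule (contractAlgebra k C) C,
    c ∈ M ∧ FiniteDimensional k (M.restrictScalars k) ∧
      ∀ M' : Submodule (contractAlgebra k C) C, c ∈ M' → M ≤ M' := by
  classical
  let D : Submodule k C := Submodule.span k
    (Set.range fun p : (C →ₗ[k] k) × (C →ₗ[k] k) => contractLeft p.2 (contractRight p.1 c))
  have hr : ∀ f : C →ₗ[k] k, ∀ x ∈ D, contractRight f x ∈ D := by
    intro f
    change D ≤ D.comap (contractRight f)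
    refine Submodule.span_le.2 ?_
    rintro _ ⟨p, rfl⟩
    refine Submodule.subset_span ⟨(conv f p.1, p.2), ?_⟩
    simp only [contractRight_conv, contractRight_contractLeft]
  have hl : ∀ f : C →ₗ[k] k, ∀ x ∈ D, contractLeft f x ∈ D := by
    intro f
    change D ≤ D.comap (contractLeft f)
    refine Submodule.span_le.2 ?_
    rintro _ ⟨p, rfl⟩
    refine Submodule.subset_span ⟨(p.1, conv p.2 f), ?_⟩
    simp only [contractLeft_conv]
  refine ⟨contractSubmodule D hr hl, ?_, ?_, ?_⟩
  · refine Submodule.subset_span ⟨(Coalgebra.counit, Coalgebra.counit), ?_⟩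
    simp only [contractRight_counit, contractLeft_counit]
  · choose s hs using fun x : C => exists_comul_eq (k := k) x
    -- The middle legs of c₍₁₎ ⊗ c₍₂₎ ⊗ c₍₃₎, which span a space containing D.
    let Z : Finset C := (s c).biUnion fun p => (s p.1).image Prod.snd
    have hD : D ≤ Submodule.span k (Z : Set C) := by
      refine Submodule.span_le.2 ?_
      rintro _ ⟨p, rfl⟩
      have h1 : contractRight p.1 c = ∑ i ∈ s c, p.1 i.2 • i.1 := by
        simp [contractRight, hs c]
      have h2 : ∀ y, contractLeft p.2 y = ∑ i ∈ s y, p.2 i.1 • i.2 := fun y => by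
        simp [contractLeft, hs y]
      change contractLeft p.2 (contractRight p.1 c) ∈ _
      rw [h1, map_sum]
      refine Submodule.sum_mem _ fun i hi => ?_
      rw [map_smul, h2]
      refine Submodule.smul_mem _ _ (Submodule.sum_mem _
        fun j hj => Submodule.smul_mem _ _ (Submodule.subset_span ?_))
      exact Finset.mem_coe.2 (Finset.mem_biUnion.2 ⟨i, hi, Finset.mem_image.2 ⟨j, hj, rfl⟩⟩)
    have : FiniteDimensional k (Submodule.span k (Z : Set C)) :=
      FiniteDimensional.span_finset k Z
    exact Submodule.finiteDimensional_of_le hD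
  · intro M' hc
    have : D ≤ M'.restrictScalars k := by
      refine Submodule.span_le.2 ?_
      rintro _ ⟨p, rfl⟩
      exact contractLeft_mem_of_mem _ _ (contractRight_mem_of_mem _ _ hc)
    exact this

variable (k C) in
/-- The socle of `C` under both actions of the dual algebra. -/
def contractSocle : Submodule (contractAlgebra k C) C :=
  ⨆ M ∈ {M : Submodule (contractAlgebra k C) C | IsSimpleModule (contractAlgebra k C) M}, M

instance : IsSemisimpleModule (contractAlgebra k C) (contractSocle k C) :=
  isSemisimpleModule_biSup_of_isSemisimpleModule_submodule (p := id) fun M hM => by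
    have : IsSimpleModule (contractAlgebra k C) M := hM
    exact inferInstanceAs (IsSemisimpleModule _ M)

/-- Subspaces stable under both actions are exactly the subcoalgebras, so a simple subcoalgebra is a
simple module. -/
theorem coradical_le_contractSocle : coradical k C ≤ (contractSocle k C).restrictScalars k := by
  refine sSup_le fun D hD => ?_
  obtain ⟨hD, hne, hmin⟩ := hD
  let M := contractSubmodule D (fun f _ hx => IsSubcoalgebra.contractRight_mem hD f hx)
    (fun f _ hx => IsSubcoalgebra.contractLeft_mem hD f hx)
  have hM : IsAtom M := by
    refine ⟨fun h => hne ?_, fun N hN => ?_⟩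
    · refine (Submodule.eq_bot_iff _).2 fun x hx => ?_
      have : x ∈ M := hx
      rw [h] at this
      exact this
    · rcases hmin (N.restrictScalars k) (fun x hx => hN.le hx)
        (isSubcoalgebra_restrictScalars N) with h | h
      · refine (Submodule.eq_bot_iff _).2 fun x hx => ?_
        have : x ∈ N.restrictScalars k := hx
        rw [h] at this
        exact this
      · refine absurd ?_ hN.not_ge
        intro x hx
        have : x ∈ D := hx
        rw [← h] at this
        exact this
  have h := le_biSup (fun M : Submodule (contractAlgebra k C) C => M)
    (show M ∈ {M : Submodule (contractAlgebra k C) C | IsSimpleModule (contractAlgebra k C) M}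
      from isSimpleModule_iff_isAtom.2 hM)
  exact fun x hx => h hx

/-! ### The radical of the dual algebra -/

variable (k C) in
/-- The functionals vanishing on the coradical. -/
def dualRadical : @Submodule k (WithConv (C →ₗ[k] k)) _ _ Algebra.toModule where
  carrier := {f | ∀ x ∈ coradical k C, f.ofConv x = 0}
  zero_mem' := fun x _ => rfl
  add_mem' := fun ha hb x hx => by simp [ha x hx, hb x hx]
  smul_mem' := fun c a ha x hx => by simp [ha x hx]

theorem dualRadical_pow_apply (n : ℕ) {f : WithConv (C →ₗ[k] k)}
    (hf : f ∈ dualRadical k C ^ (n + 1)) {x : C} (hx : x ∈ coradicalFiltration k C n) :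
    f.ofConv x = 0 := by
  induction n generalizing f x with
  | zero =>
    rw [zero_add, pow_one] at hf
    exact hf x hx
  | succ n ih =>
    rw [pow_succ'] at hf
    induction hf using Submodule.mul_induction_on' with
    | add a _ b _ ha hb => simp [ha, hb]
    | mem_mul_mem a ha b hb =>
      -- In a ⋆ b the factor a kills C₀ and, by induction, b kills Cₙ; Δ(x) has one leg in one of
      -- these.
      have h : tensorSubspace k ⊤ (coradicalFiltration k C n) ⊔
          tensorSubspace k (coradical k C) ⊤ ≤
          LinearMap.ker (LinearMap.mul' k k ∘ₗ TensorProduct.map a.ofConv b.ofConv) := by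
        refine sup_le (Submodule.map₂_le.2 fun y _ z hz => ?_)
          (Submodule.map₂_le.2 fun y hy z _ => ?_)
        · simp [ih hb hz]
        · simp [ha y hy]
      exact h hx

/-- If the coradical filtration is finite, some nonzero functional is annihilated by the radical
of the dual algebra on both sides. -/
theorem exists_ne_zero_contract_mem_coradical (hC : HasFiniteCoradicalFiltration k C)
    (hne : ∃ x : C, Coalgebra.counit (R := k) x ≠ 0) : ∃ g : C →ₗ[k] k, g ≠ 0 ∧
      (∀ x, contractRight g x ∈ coradical k C) ∧ (∀ x, contractLeft g x ∈ coradical k C) := by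
  classical
  obtain ⟨n, hn⟩ := hC
  have hex : ∃ m, dualRadical k C ^ m = ⊥ := by
    refine ⟨n + 1, (Submodule.eq_bot_iff _).2 fun f hf => ?_⟩
    ext x
    exact dualRadical_pow_apply n hf (by rw [hn]; trivial)
  -- J⁰ contains ε ≠ 0, so the least vanishing exponent is positive and m is the last exponent with
  -- Jᵐ ≠ 0.
  obtain ⟨m, hm⟩ : ∃ m, Nat.find hex = m + 1 := by
    refine Nat.exists_eq_succ_of_ne_zero fun h0 => ?_
    have h := Nat.find_spec hex
    rw [h0, pow_zero] at h
    have h1 : (1 : WithConv (C →ₗ[k] k)) = 0 := by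
      have : (1 : WithConv (C →ₗ[k] k)) ∈ (1 : Submodule k (WithConv (C →ₗ[k] k))) :=
        Submodule.one_le.1 le_rfl
      rw [h] at this
      exact this
    obtain ⟨x, hx⟩ := hne
    exact hx (LinearMap.congr_fun (congrArg WithConv.ofConv h1) x)
  have hbot : dualRadical k C ^ (m + 1) = ⊥ := hm ▸ Nat.find_spec hex
  obtain ⟨g, hg, hg0⟩ := Submodule.exists_mem_ne_zero_of_ne_bot
    (Nat.find_min hex (m := m) (by omega))
  -- A subspace is the common kernel of the functionals vanishing on it.
  have hmem : ∀ y : C, (∀ a ∈ dualRadical k C, a.ofConv y = 0) → y ∈ coradical k C := by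
    intro y hy
    by_contra hny
    obtain ⟨a, hay, ha⟩ := Submodule.exists_le_ker_of_notMem hny
    exact hay (hy (WithConv.toConv a) fun x hx => ha hx)
  refine ⟨g.ofConv, fun h => hg0 (WithConv.ext h), fun x => hmem _ fun a ha => ?_,
    fun x => hmem _ fun a ha => ?_⟩
  · rw [apply_contractRight]
    have h : a * g ∈ dualRadical k C ^ (m + 1) := by
      rw [pow_succ']; exact Submodule.mul_mem_mul ha hg
    rw [hbot, Submodule.mem_bot] at h
    exact LinearMap.congr_fun (congrArg WithConv.ofConv h) x
  · rw [apply_contractLeft]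
    have h : g * a ∈ dualRadical k C ^ (m + 1) := by
      rw [pow_succ]; exact Submodule.mul_mem_mul hg ha
    rw [hbot, Submodule.mem_bot] at h
    exact LinearMap.congr_fun (congrArg WithConv.ofConv h) x

end CoalgebraDual
end

/-! ### Reduction to a finite-dimensional subcoalgebra and its matrix coefficients -/

noncomputable section

namespace CoalgebraDual

variable {k C : Type*} [Field k] [AddCommGroup C] [Module k C] [Coalgebra k C]

/-- A finite-dimensional subcoalgebra of the socle containing a given element is a direct summand
under the actions of the dual algebra. -/
theorem exists_finiteDimensional_retraction {c : C} (hc : c ∈ contractSocle k C) :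
    ∃ (M : Submodule (contractAlgebra k C) C) (h : contractSocle k C →ₗ[contractAlgebra k C] M),
      FiniteDimensional k (M.restrictScalars k) ∧ (h ⟨c, hc⟩ : C) = c := by
  obtain ⟨M, hcM, hfd, hmin⟩ := exists_finiteDimensional_submodule (k := k) c
  have hle : M ≤ contractSocle k C := hmin _ hc
  obtain ⟨h, hh⟩ := IsSemisimpleModule.extension_property (R := contractAlgebra k C)
    (M := contractSocle k C) (N := M) (P := M) (Submodule.inclusion hle)
    (Submodule.inclusion_injective hle) LinearMap.id
  exact ⟨M, h, hfd, congrArg Subtype.val (LinearMap.congr_fun hh ⟨c, hcM⟩)⟩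

/-- The functional `ε ∘ h`, extended to the whole coalgebra. -/
theorem exists_extend_counit {M : Submodule (contractAlgebra k C) C}
    (h : contractSocle k C →ₗ[contractAlgebra k C] M) : ∃ e : C →ₗ[k] k,
      (∀ y (hy : y ∈ contractSocle k C), e y = Coalgebra.counit (R := k) (h ⟨y, hy⟩ : C)) ∧
      (∀ y (hy : y ∈ contractSocle k C), contractRight e y = h ⟨y, hy⟩) ∧
      (∀ y (hy : y ∈ contractSocle k C), contractLeft e y = h ⟨y, hy⟩) := by
  let e₀ : (contractSocle k C).restrictScalars k →ₗ[k] k :=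
    Coalgebra.counit ∘ₗ (M.restrictScalars k).subtype ∘ₗ
      { toFun := fun y => h y
        map_add' := fun a b => h.map_add a b
        map_smul' := fun r a => h.map_smul (algebraMap k (contractAlgebra k C) r) a }
  obtain ⟨e, he⟩ := e₀.exists_extend
  have he' : ∀ (y : C) (hy : y ∈ contractSocle k C),
      e y = Coalgebra.counit (R := k) (h ⟨y, hy⟩ : C) := fun y hy =>
    LinearMap.congr_fun he (⟨y, hy⟩ : Submodule.restrictScalars k (contractSocle k C))
  -- Since h commutes with both actions, a(y₍₁₎) e(y₍₂₎) = ε(h(a(y₍₁₎) y₍₂₎)) = a(h(y)), and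
  -- symmetrically on the other side.
  refine ⟨e, he', fun y hy => dual_ext (k := k) fun a => ?_,
    fun y hy => dual_ext (k := k) fun a => ?_⟩
  · have h1 : (h ⟨contractLeft a y, contractLeft_mem_of_mem _ a hy⟩ : C) =
        contractLeft a (h ⟨y, hy⟩ : C) :=
      congrArg Subtype.val (h.map_smul ⟨contractLeft a, contractLeft_mem a⟩ ⟨y, hy⟩)
    rw [apply_contractRight, ← apply_contractLeft, he' _ (contractLeft_mem_of_mem _ a hy), h1,
      apply_contractLeft, conv_counit]
  · have h1 : (h ⟨contractRight a y, contractRight_mem_of_mem _ a hy⟩ : C) =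
        contractRight a (h ⟨y, hy⟩ : C) :=
      congrArg Subtype.val (h.map_smul ⟨contractRight a, contractRight_mem a⟩ ⟨y, hy⟩)
    rw [apply_contractLeft, ← apply_contractRight, he' _ (contractRight_mem_of_mem _ a hy), h1,
      apply_contractRight, counit_conv]

/-- The functional is f = e ⋆ g with e = ε ∘ h, where h retracts the socle onto a finite-dimensional
subcoalgebra containing the contraction of g at a point x₀ with g(x₀) ≠ 0. As h fixes that
contraction, f(x₀) = g(x₀). -/
theorem exists_contractRight_mem_finiteDimensional {g : C →ₗ[k] k} (hg : g ≠ 0)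
    (hgC : ∀ x, contractRight g x ∈ coradical k C) :
    ∃ (M : Submodule (contractAlgebra k C) C) (f : C →ₗ[k] k),
      FiniteDimensional k (M.restrictScalars k) ∧ f ≠ 0 ∧ ∀ x, contractRight f x ∈ M := by
  obtain ⟨x₀, hx₀⟩ : ∃ x, g x ≠ 0 := by
    by_contra! h
    exact hg (LinearMap.ext h)
  have hs : ∀ x, contractRight g x ∈ contractSocle k C := fun x =>
    coradical_le_contractSocle (hgC x)
  obtain ⟨M, h, hfd, hc⟩ := exists_finiteDimensional_retraction (hs x₀)
  obtain ⟨e, he, her, -⟩ := exists_extend_counit h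
  refine ⟨M, conv e g, hfd, fun h0 => hx₀ ?_, fun x => ?_⟩
  · have h1 := LinearMap.congr_fun h0 x₀
    rw [← apply_contractRight, he _ (hs x₀), hc, apply_contractRight, counit_conv] at h1
    exact h1
  · rw [contractRight_conv, her _ (hs x)]
    exact (h _).2

theorem exists_contractLeft_mem_finiteDimensional {g : C →ₗ[k] k} (hg : g ≠ 0)
    (hgC : ∀ x, contractLeft g x ∈ coradical k C) :
    ∃ (M : Submodule (contractAlgebra k C) C) (f : C →ₗ[k] k),
      FiniteDimensional k (M.restrictScalars k) ∧ f ≠ 0 ∧ ∀ x, contractLeft f x ∈ M := by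
  obtain ⟨x₀, hx₀⟩ : ∃ x, g x ≠ 0 := by
    by_contra! h
    exact hg (LinearMap.ext h)
  have hs : ∀ x, contractLeft g x ∈ contractSocle k C := fun x =>
    coradical_le_contractSocle (hgC x)
  obtain ⟨M, h, hfd, hc⟩ := exists_finiteDimensional_retraction (hs x₀)
  obtain ⟨e, he, -, hel⟩ := exists_extend_counit h
  refine ⟨M, conv g e, hfd, fun h0 => hx₀ ?_, fun x => ?_⟩
  · have h1 := LinearMap.congr_fun h0 x₀
    rw [← apply_contractLeft, he _ (hs x₀), hc, apply_contractLeft, conv_counit] at h1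
    exact h1
  · rw [contractLeft_conv, hel _ (hs x)]
    exact (h _).2

/-- A finite basis of a finite-dimensional submodule, with a dual family of functionals. -/
theorem exists_dual_family (M : Submodule (contractAlgebra k C) C)
    [FiniteDimensional k (M.restrictScalars k)] : ∃ (n : ℕ) (w : Fin n → C) (φ : Fin n → C →ₗ[k] k),
      (∀ i, w i ∈ M) ∧ (∀ i j, φ j (w i) = if i = j then 1 else 0) ∧
      ∀ y ∈ M, y = ∑ i, φ i y • w i := by
  let b := Module.finBasis k (M.restrictScalars k)
  choose φ hφ using fun i => (b.coord i).exists_extend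
  have hφ' : ∀ i (y : M.restrictScalars k), φ i y = b.repr y i := fun i y =>
    LinearMap.congr_fun (hφ i) y
  refine ⟨_, fun i => b i, φ, fun i => (b i).2, fun i j => ?_, fun y hy => ?_⟩
  · rw [hφ' j (b i), b.repr_self, Finsupp.single_apply]
  · have h := congrArg Subtype.val (b.sum_repr ⟨y, hy⟩)
    refine h.symm.trans ?_
    simp [← hφ']

/-- The comultiplication of a multiplicative matrix of coefficients. -/
theorem comul_contractRight (f : C →ₗ[k] k) (x : C) : Coalgebra.comul (R := k) (contractRight f x) =
    (contractRight f).lTensor C (Coalgebra.comul (R := k) x) := by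
  refine tensor_ext_dual fun a b => ?_
  have h : LinearMap.mul' k k (TensorProduct.map a b
      ((contractRight f).lTensor C (Coalgebra.comul (R := k) x))) = conv a (conv b f) x := by
    obtain ⟨s, hs⟩ := exists_comul_eq (k := k) x
    rw [conv_apply_of_comul_eq hs]
    simp [hs, apply_contractRight]
  rw [h, ← conv_assoc, ← apply_contractRight]
  rfl

theorem comul_contractLeft (f : C →ₗ[k] k) (x : C) : Coalgebra.comul (R := k) (contractLeft f x) =
    (contractLeft f).rTensor C (Coalgebra.comul (R := k) x) := by
  refine tensor_ext_dual fun a b => ?_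
  have h : LinearMap.mul' k k (TensorProduct.map a b
      ((contractLeft f).rTensor C (Coalgebra.comul (R := k) x))) = conv (conv f a) b x := by
    obtain ⟨s, hs⟩ := exists_comul_eq (k := k) x
    rw [conv_apply_of_comul_eq hs]
    simp [hs, apply_contractLeft]
  rw [h, conv_assoc, ← apply_contractLeft]
  rfl

/-- If `f ≠ 0` and all `x₍₁₎ f(x₍₂₎)` lie in a finite-dimensional subcoalgebra, there are
functionals, not all zero, that transform by a matrix of coefficients. -/
theorem exists_matrix_contractRight {M : Submodule (contractAlgebra k C) C}
    [FiniteDimensional k (M.restrictScalars k)] {f : C →ₗ[k] k} (hf : f ≠ 0)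
    (hM : ∀ x, contractRight f x ∈ M) :
    ∃ (n : ℕ) (F : Fin n → C →ₗ[k] k) (a : Fin n → Fin n → C), (∃ j, F j ≠ 0) ∧
      (∀ j x, contractRight (F j) x = ∑ i, F i x • a i j) ∧
      (∀ i j, Coalgebra.comul (R := k) (a i j) = ∑ l, a i l ⊗ₜ[k] a l j) ∧
      ∀ i j, Coalgebra.counit (R := k) (a i j) = if i = j then 1 else 0 := by
  obtain ⟨n, w, φ, hw, hφ, hy⟩ := exists_dual_family M
  have hF : ∀ i x, φ i (contractRight f x) = conv (φ i) f x := fun i x => apply_contractRight _ _ _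
  have hcw : ∀ i, Coalgebra.comul (R := k) (w i) = ∑ l, contractRight (φ l) (w i) ⊗ₜ[k] w l := by
    intro i
    refine tensor_ext_dual fun a b => ?_
    have h1 := congrArg b (hy _ (contractLeft_mem_of_mem M a (hw i)))
    change conv a b (w i) = _
    rw [← apply_contractLeft, h1]
    simp [apply_contractLeft, apply_contractRight]
  -- The Fⱼ are the coordinates of x₍₁₎ f(x₍₂₎) in the basis w, and the aᵢⱼ = wᵢ₍₁₎ φⱼ(wᵢ₍₂₎) are
  -- the matrix coefficients of M.
  refine ⟨n, fun j => conv (φ j) f, fun i j => contractRight (φ j) (w i), ?_, fun j x => ?_,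
    fun i j => ?_, fun i j => ?_⟩
  · by_contra! h
    refine hf (LinearMap.ext fun x => ?_)
    have h1 := congrArg (Coalgebra.counit (R := k)) (hy _ (hM x))
    simp only [hF, h, LinearMap.zero_apply, zero_smul, Finset.sum_const_zero, map_zero] at h1
    rw [apply_contractRight, counit_conv] at h1
    exact h1
  · rw [contractRight_conv, hy _ (hM x), map_sum]
    simp only [map_smul, hF]
  · rw [comul_contractRight, hcw]
    simp
  · rw [apply_contractRight, counit_conv, hφ]

theorem exists_matrix_contractLeft {M : Submodule (contractAlgebra k C) C}
    [FiniteDimensional k (M.restrictScalars k)] {f : C →ₗ[k] k} (hf : f ≠ 0)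
    (hM : ∀ x, contractLeft f x ∈ M) :
    ∃ (n : ℕ) (F : Fin n → C →ₗ[k] k) (a : Fin n → Fin n → C), (∃ j, F j ≠ 0) ∧
      (∀ j x, contractLeft (F j) x = ∑ i, F i x • a j i) ∧
      (∀ i j, Coalgebra.comul (R := k) (a i j) = ∑ l, a i l ⊗ₜ[k] a l j) ∧
      ∀ i j, Coalgebra.counit (R := k) (a i j) = if i = j then 1 else 0 := by
  obtain ⟨n, w, φ, hw, hφ, hy⟩ := exists_dual_family M
  have hF : ∀ i x, φ i (contractLeft f x) = conv f (φ i) x := fun i x => apply_contractLeft _ _ _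
  have hcw : ∀ i, Coalgebra.comul (R := k) (w i) = ∑ l, w l ⊗ₜ[k] contractLeft (φ l) (w i) := by
    intro i
    refine tensor_ext_dual fun a b => ?_
    have h1 := congrArg a (hy _ (contractRight_mem_of_mem M b (hw i)))
    change conv a b (w i) = _
    rw [← apply_contractRight, h1]
    simp [apply_contractLeft, apply_contractRight, mul_comm]
  refine ⟨n, fun j => conv f (φ j), fun j i => contractLeft (φ j) (w i), ?_, fun j x => ?_,
    fun i j => ?_, fun i j => ?_⟩
  · by_contra! h
    refine hf (LinearMap.ext fun x => ?_)
    have h1 := congrArg (Coalgebra.counit (R := k)) (hy _ (hM x))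
    simp only [hF, h, LinearMap.zero_apply, zero_smul, Finset.sum_const_zero, map_zero] at h1
    rw [apply_contractLeft, conv_counit] at h1
    exact h1
  · rw [contractLeft_conv, hy _ (hM x), map_sum]
    simp only [map_smul, hF]
  · rw [comul_contractLeft, hcw]
    simp
  · rw [apply_contractLeft, conv_counit, hφ]
    simp only [eq_comm]

end CoalgebraDual
end

/-! ### Construction of the integrals -/

noncomputable section

namespace BraidedHopf

open YetterDrinfeld CoalgebraDual

variable {k H R : Type*} [Field k] [Ring H] [HopfAlgebra k H]
    [Ring R] [Algebra k R] [Coalgebra k R] [Module H R] [IsScalarTower k H R]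
    [YetterDrinfeldModule k H R] [BraidedHopfAlgebra k H R]

section Integrals

theorem isLeftCoFrobenius_of_contractRight {l : R →ₗ[k] k} (hl : l ≠ 0)
    (h : ∀ x, contractRight l x = l x • 1) : IsLeftCoFrobenius k R := by
  refine (Submodule.ne_bot_iff _).2 ⟨WithConv.toConv l, fun f => ?_, fun h0 =>
    hl (congrArg WithConv.ofConv h0)⟩
  ext x
  have h1 := congrArg f.ofConv (h x)
  rw [apply_contractRight, map_smul, smul_eq_mul, mul_comm] at h1
  exact h1

theorem isRightCoFrobenius_of_contractLeft {l : R →ₗ[k] k} (hl : l ≠ 0)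
    (h : ∀ x, contractLeft l x = l x • 1) : IsRightCoFrobenius k R := by
  refine (Submodule.ne_bot_iff _).2 ⟨WithConv.toConv l, fun f => ?_, fun h0 =>
    hl (congrArg WithConv.ofConv h0)⟩
  ext x
  have h1 := congrArg f.ofConv (h x)
  rw [apply_contractLeft, map_smul, smul_eq_mul, mul_comm] at h1
  exact h1

omit [Coalgebra k R] in
theorem rid_lTensor_legOne (f : R →ₗ[k] k) (e : Module.End k R) (t : R ⊗[k] R) :
    TensorProduct.rid k R (f.lTensor R (legOne k R e t)) =
      e (TensorProduct.rid k R (f.lTensor R t)) := by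
  induction t with
  | zero => simp
  | add a b ha hb => simp only [map_add, ha, hb]
  | tmul a b => simp

omit [Coalgebra k R] in
theorem lid_rTensor_legTwo (f : R →ₗ[k] k) (e : Module.End k R) (t : R ⊗[k] R) :
    TensorProduct.lid k R (f.rTensor R (legTwo k R e t)) =
      e (TensorProduct.lid k R (f.rTensor R t)) := by
  induction t with
  | zero => simp
  | add a b ha hb => simp only [map_add, ha, hb]
  | tmul a b => simp

omit [Coalgebra k R] [BraidedHopfAlgebra k H R] in
theorem sum_counit_smul_coact {ι : Type*} {s : Finset ι} {v : R} {a : ι → H} {b : ι → R}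
    (hv : coact k H R v = ∑ i ∈ s, a i ⊗ₜ[k] b i) :
    ∑ i ∈ s, Coalgebra.counit (R := k) (a i) • b i = v := by
  have h2 := congrArg (TensorProduct.lid k R)
    (LinearMap.congr_fun (LeftComodule.counit_coact (k := k) (C := H) (V := R)) v)
  simpa [show LeftComodule.coact v = _ from hv] using h2

theorem counit_bosonSquare (r : R) :
    Coalgebra.counit (R := k) (bosonSquare (k := k) (H := H) R r) =
      Coalgebra.counit (R := k) r := by
  rw [← counit_antipode k H R r, ← counit_antipode k H R (S k H R r)]
  change Coalgebra.counit (R := k) (twistBy k H R _ _) = _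
  generalize S k H R (S k H R r) = v
  obtain ⟨s, hs⟩ := exists_coact_eq (k := k) (H := H) v
  have h := congrArg (Coalgebra.counit (R := k)) (sum_counit_smul_coact hs)
  rw [← h, twistBy_eq_sum _ hs]
  simp [BraidedHopfAlgebra.counit_smul]

/-- The left integrals attached to functionals that transform by a matrix of coefficients. -/
theorem contractRight_sum_eq {n : ℕ} {F : Fin n → R →ₗ[k] k} {p : Fin n → Fin n → R}
    (hF : ∀ j x, contractRight (F j) x = ∑ i, F i x • bosonSquare (k := k) (H := H) R (p i j))
    (hp : ∀ i j, Coalgebra.comul (R := k) (p i j) = ∑ l, p i l ⊗ₜ[k] p l j)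
    (hε : ∀ i j, Coalgebra.counit (R := k) (p i j) = if i = j then 1 else 0) (j : Fin n) (x : R) :
    contractRight (∑ i, F i ∘ₗ lm k R (p i j)) x = (∑ i, F i ∘ₗ lm k R (p i j)) x • 1 := by
  choose u hu using fun y : R => exists_coact_eq (k := k) (H := H) y
  have h1 : contractRight (∑ i, F i ∘ₗ lm k R (p i j)) x = ∑ i, TensorProduct.rid k R
      ((F i).lTensor R (legTwo k R (lm k R (p i j)) (Coalgebra.comul (R := k) x))) := by
    obtain ⟨s, hs⟩ := exists_comul_eq (k := k) x
    simp only [CoalgebraDual.contractRight, hs, LinearMap.comp_apply, map_sum,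
      LinearMap.lTensor_tmul, legTwo_tmul, LinearEquiv.coe_coe, TensorProduct.rid_tmul, LinearMap.sum_apply,
      Finset.sum_smul]
    exact Finset.sum_comm
  have h2 : ∀ i, TensorProduct.rid k R
      ((F i).lTensor R (legTwo k R (lm k R (p i j)) (Coalgebra.comul (R := k) x))) =
      ∑ l, ∑ q ∈ u (p l j), ∑ m, F m (q.2 * x) • HopfAlgebra.antipode k q.1 •
        (bosonAntipode k H R (p i l) * bosonAntipode k H R (S k H R (p m i))) 1 := by
    intro i
    rw [legTwo_lm_eq_sum k H R (hp i j), LinearMap.sum_apply, map_sum, map_sum]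
    refine Finset.sum_congr rfl fun l _ => ?_
    rw [coactConv_apply_of_coact_eq (hu (p l j)), LinearMap.sum_apply, map_sum, map_sum]
    refine Finset.sum_congr rfl fun q _ => ?_
    have h3 : TensorProduct.rid k R ((F i).lTensor R (Coalgebra.comul (R := k) (q.2 * x))) =
        contractRight (F i) (q.2 * x) := rfl
    simp only [LinearMap.comp_apply, LinearMap.mulRight_apply, Module.End.mul_apply,
      ← comul_mul_eq, AlgHom.toLinearMap_apply, rid_lTensor_legOne, h3, hF, map_sum, map_smul,
      bosonSquare_eq, act_apply]
  -- The twist by `bosonSquare` in `hF` supplies κ(S(pₘᵢ)), so the sum over i is an antipode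
  -- identity.
  have h3 : ∀ l m, ∑ i, bosonAntipode k H R (p i l) * bosonAntipode k H R (S k H R (p m i)) =
      (if m = l then (1 : k) else 0) • 1 := fun l m => by
    rw [sum_bosonAntipode_mul_antipode (hp m l), hε]
  rw [h1]
  simp only [h2]
  rw [Finset.sum_comm, LinearMap.sum_apply, Finset.sum_smul]
  refine Finset.sum_congr rfl fun l _ => ?_
  rw [Finset.sum_comm]
  have h4 : ∀ q : H × R, ∑ i, ∑ m, F m (q.2 * x) • HopfAlgebra.antipode k q.1 •
      (bosonAntipode k H R (p i l) * bosonAntipode k H R (S k H R (p m i))) 1 =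
      (Coalgebra.counit (R := k) q.1 * F l (q.2 * x)) • (1 : R) := by
    intro q
    rw [Finset.sum_comm]
    simp only [← Finset.smul_sum, ← LinearMap.sum_apply, h3]
    rw [Finset.sum_eq_single l (fun m _ hm => by simp [hm]) (by simp), if_pos rfl, one_smul,
      Module.End.one_apply, BraidedHopfAlgebra.smul_one (k := k), HopfAlgebra.counit_antipode,
      smul_smul, mul_comm]
  simp only [h4, ← Finset.sum_smul]
  congr 1
  have h5 := congrArg (fun z => F l (z * x)) (sum_counit_smul_coact (hu (p l j)))
  simpa [Finset.sum_mul] using h5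

/-- The left integrals determine the Fₗ, so they cannot all vanish. -/
theorem sum_lm_antipode {n : ℕ} {F : Fin n → R →ₗ[k] k} {p : Fin n → Fin n → R}
    (hp : ∀ i j, Coalgebra.comul (R := k) (p i j) = ∑ l, p i l ⊗ₜ[k] p l j)
    (hε : ∀ i j, Coalgebra.counit (R := k) (p i j) = if i = j then 1 else 0) (l : Fin n) (x : R) :
    ∑ j, (∑ i, F i ∘ₗ lm k R (p i j)) (S k H R (p j l) * x) = F l x := by
  have h1 : ∀ i, ∑ j, p i j * (S k H R (p j l) * x) = (if i = l then (1 : k) else 0) • x := by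
    intro i
    have h := LinearMap.congr_fun (LinearMap.congr_fun (conv_lm_lmS k H R) (p i l)) x
    rw [conv_apply_of_comul_eq (hp i l), convUnit_apply, hε, LinearMap.smul_apply,
      LinearMap.sum_apply] at h
    exact h
  simp only [LinearMap.sum_apply, LinearMap.comp_apply]
  rw [Finset.sum_comm]
  simp only [← map_sum, LinearMap.mul_apply', h1]
  simp [ite_smul, apply_ite]

/-- The right integrals attached to functionals that transform by a matrix of coefficients. -/
theorem contractLeft_sum_eq {n : ℕ} {F : Fin n → R →ₗ[k] k} {p : Fin n → Fin n → R}
    (hF : ∀ j x, contractLeft (F j) x = ∑ i, F i x • p j i)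
    (hp : ∀ i j, Coalgebra.comul (R := k) (p i j) = ∑ l, p i l ⊗ₜ[k] p l j)
    (hε : ∀ i j, Coalgebra.counit (R := k) (p i j) = if i = j then 1 else 0) (j : Fin n) (x : R) :
    contractLeft (∑ i, F i ∘ₗ bosonAntipode k H R (S k H R (p j i))) x =
      (∑ i, F i ∘ₗ bosonAntipode k H R (S k H R (p j i))) x • 1 := by
  choose u hu using fun y : R => exists_coact_eq (k := k) (H := H) y
  have h1 : contractLeft (∑ i, F i ∘ₗ bosonAntipode k H R (S k H R (p j i))) x =
      ∑ i, TensorProduct.lid k R ((F i).rTensor R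
        (legOne k R (bosonAntipode k H R (S k H R (p j i))) (Coalgebra.comul (R := k) x))) := by
    obtain ⟨s, hs⟩ := exists_comul_eq (k := k) x
    simp only [CoalgebraDual.contractLeft, hs, LinearMap.comp_apply, map_sum,
      LinearMap.rTensor_tmul, legOne_tmul, LinearEquiv.coe_coe, TensorProduct.lid_tmul, LinearMap.sum_apply,
      Finset.sum_smul]
    exact Finset.sum_comm
  -- κ(S(-)) plays the role of left multiplication by S²; the factor it leaves on the other leg is
  -- S(pₗᵢ), which meets pᵢₘ from `hF` without any inverse antipode.
  have h2 : ∀ i, TensorProduct.lid k R ((F i).rTensor R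
        (legOne k R (bosonAntipode k H R (S k H R (p j i))) (Coalgebra.comul (R := k) x))) =
      ∑ l, ∑ q ∈ u (p j l), ∑ m, F m (bosonAntipode k H R (S k H R q.2) x) •
        q.1 • (S k H R (p l i) * p i m) := by
    intro i
    rw [legOne_bosonAntipode_antipode_eq_sum (hp j i), LinearMap.sum_apply, map_sum, map_sum]
    refine Finset.sum_congr rfl fun l _ => ?_
    rw [coactConv_apply_of_coact_eq (hu (p j l)), LinearMap.sum_apply, map_sum, map_sum]
    refine Finset.sum_congr rfl fun q _ => ?_
    have h3 : ∀ y, TensorProduct.lid k R ((F i).rTensor R (Coalgebra.comul (R := k) y)) =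
        contractLeft (F i) y := fun y => rfl
    simp only [LinearMap.comp_apply, LinearMap.mulRight_apply, Module.End.mul_apply,
      ← comul_bosonAntipode, AlgHom.toLinearMap_apply, lid_rTensor_legTwo, h3, hF, map_sum,
      map_smul, act_apply, LinearMap.mul_apply']
  have h3 : ∀ l m, ∑ i, S k H R (p l i) * p i m = (if l = m then (1 : k) else 0) • 1 := by
    intro l m
    have h := LinearMap.congr_fun (LinearMap.congr_fun (conv_lmS_lm k H R) (p l m)) 1
    rw [conv_apply_of_comul_eq (hp l m), convUnit_apply, hε, LinearMap.smul_apply] at h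
    simpa [-ite_smul] using h
  rw [h1]
  simp only [h2]
  rw [Finset.sum_comm, LinearMap.sum_apply, Finset.sum_smul]
  refine Finset.sum_congr rfl fun l _ => ?_
  rw [Finset.sum_comm]
  have h4 : ∀ q : H × R, ∑ i, ∑ m, F m (bosonAntipode k H R (S k H R q.2) x) •
        q.1 • (S k H R (p l i) * p i m) =
      (Coalgebra.counit (R := k) q.1 * F l (bosonAntipode k H R (S k H R q.2) x)) • (1 : R) := by
    intro q
    rw [Finset.sum_comm]
    simp only [← Finset.smul_sum, h3]
    rw [Finset.sum_eq_single l (fun m _ hm => by simp [hm.symm]) (by simp), if_pos rfl, one_smul,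
      BraidedHopfAlgebra.smul_one (k := k), smul_smul, mul_comm]
  simp only [h4, ← Finset.sum_smul]
  congr 1
  have h5 := congrArg (fun z => F l (bosonAntipode k H R (S k H R z) x))
    (sum_counit_smul_coact (hu (p j l)))
  simpa using h5

/-- The right integrals determine the Fₗ, so they cannot all vanish. -/
theorem sum_bosonAntipode_apply {n : ℕ} {F : Fin n → R →ₗ[k] k} {p : Fin n → Fin n → R}
    (hp : ∀ i j, Coalgebra.comul (R := k) (p i j) = ∑ l, p i l ⊗ₜ[k] p l j)
    (hε : ∀ i j, Coalgebra.counit (R := k) (p i j) = if i = j then 1 else 0) (l : Fin n) (x : R) :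
    ∑ j, (∑ i, F i ∘ₗ bosonAntipode k H R (S k H R (p j i))) (bosonAntipode k H R (p l j) x) =
      F l x := by
  have h1 : ∀ i, ∑ j, bosonAntipode k H R (S k H R (p j i)) (bosonAntipode k H R (p l j) x) =
      (if l = i then (1 : k) else 0) • x := by
    intro i
    have h := LinearMap.congr_fun (sum_bosonAntipode_antipode_mul (H := H) (hp l i)) x
    rw [hε, LinearMap.smul_apply,
      LinearMap.sum_apply] at h
    exact h
  simp only [LinearMap.sum_apply, LinearMap.comp_apply]
  rw [Finset.sum_comm]
  simp only [← map_sum, h1]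
  simp [ite_smul, apply_ite]

theorem isLeftCoFrobenius (hH : Function.Bijective (HopfAlgebra.antipode k (A := H)))
    (hR : Function.Bijective (S k H R)) (hfin : HasFiniteCoradicalFiltration k R) :
    IsLeftCoFrobenius k R := by
  obtain ⟨g, hg, hgr, -⟩ := exists_ne_zero_contract_mem_coradical hfin
    ⟨1, by rw [BraidedHopfAlgebra.counit_one (k := k) (H := H)]; exact one_ne_zero⟩
  obtain ⟨M, f, hfd, hf, hfM⟩ := exists_contractRight_mem_finiteDimensional hg hgr
  obtain ⟨n, F, a, ⟨l, hl⟩, hF, ha, hε⟩ := exists_matrix_contractRight hf hfM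
  let σ := LinearEquiv.ofBijective _ (bijective_bosonSquare (k := k) R hH hR)
  -- As σ is a coalgebra automorphism, the preimages pᵢⱼ again form a matrix of coefficients.
  choose p hp using fun i j => σ.surjective (a i j)
  have hp' : ∀ i j, bosonSquare (k := k) (H := H) R (p i j) = a i j := hp
  have hpc : ∀ i j, Coalgebra.comul (R := k) (p i j) = ∑ l, p i l ⊗ₜ[k] p l j := by
    intro i j
    apply (TensorProduct.congr σ σ).injective
    refine (comul_bosonSquare R (p i j)).symm.trans ?_
    rw [hp', ha, map_sum]
    refine Finset.sum_congr rfl fun l _ => ?_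
    rw [TensorProduct.congr_tmul, hp, hp]
  have hpε : ∀ i j, Coalgebra.counit (R := k) (p i j) = if i = j then 1 else 0 := by
    intro i j
    rw [← hε, ← hp', counit_bosonSquare]
  have hF' : ∀ j x, contractRight (F j) x =
      ∑ i, F i x • bosonSquare (k := k) (H := H) R (p i j) := by
    simpa only [hp'] using hF
  have hint := contractRight_sum_eq hF' hpc hpε
  by_contra hno
  have hzero : ∀ j, ∑ i, F i ∘ₗ lm k R (p i j) = 0 := fun j => by
    by_contra hj
    exact hno (isLeftCoFrobenius_of_contractRight hj (hint j))
  refine hl (LinearMap.ext fun x => ?_)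
  rw [← sum_lm_antipode (H := H) hpc hpε l x]
  simp only [hzero]
  simp

theorem isRightCoFrobenius (k H R : Type*) [Field k] [Ring H] [HopfAlgebra k H]
    [Ring R] [Algebra k R] [Coalgebra k R] [Module H R] [IsScalarTower k H R]
    [YetterDrinfeldModule k H R] [BraidedHopfAlgebra k H R]
    (hfin : HasFiniteCoradicalFiltration k R) :
    IsRightCoFrobenius k R := by
  obtain ⟨g, hg, -, hgl⟩ := exists_ne_zero_contract_mem_coradical hfin
    ⟨1, by rw [BraidedHopfAlgebra.counit_one (k := k) (H := H)]; exact one_ne_zero⟩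
  obtain ⟨M, f, hfd, hf, hfM⟩ := exists_contractLeft_mem_finiteDimensional hg hgl
  obtain ⟨n, F, p, ⟨l, hl⟩, hF, hp, hε⟩ := exists_matrix_contractLeft hf hfM
  have hint := contractLeft_sum_eq (H := H) hF hp hε
  by_contra hno
  have hzero : ∀ j, ∑ i, F i ∘ₗ bosonAntipode k H R (S k H R (p j i)) = 0 := fun j => by
    by_contra hj
    exact hno (isRightCoFrobenius_of_contractLeft hj (hint j))
  refine hl (LinearMap.ext fun x => ?_)
  rw [← sum_bosonAntipode_apply (H := H) hp hε l x]
  simp only [hzero]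
  simp

end Integrals

end BraidedHopf
end

theorem mainTheorem5 (k H R : Type*) [Field k]
    [Ring H] [HopfAlgebra k H]
    (hH : Function.Bijective (HopfAlgebra.antipode k (A := H)))
    [Ring R] [Algebra k R] [Coalgebra k R] [Module H R] [IsScalarTower k H R]
    [YetterDrinfeldModule k H R] [BraidedHopfAlgebra k H R]
    (hR : Function.Bijective (BraidedHopfAlgebra.antipode k H : R →ₗ[k] R))
    (hfin : HasFiniteCoradicalFiltration k R) :
    IsCoFrobenius k R :=
  ⟨BraidedHopf.isLeftCoFrobenius hH hR hfin, BraidedHopf.isRightCoFrobenius k H R hfin⟩
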